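/- Let $\mathcal B$ be the full binary tree without root (the Bethe lattice), i.e. the infinite tree obtained by joining the roots of two rooted infinite binary trees by an edge; every vertex of $\mathcal B$ has exactly three neighbours, and the rooted infinite binary tree $\mathcal B_\infty$ is a subtree of $\mathcal B$. Let $\mathcal T$ be a (nonempty) finite or infinite subtree of $\mathcal B$. A stable configuration on $\mathcal T$ is an element $\eta\in\{1,2,3\}^{\mathcal T}$. It is called recurrent if there is no finite nonempty set $S\subset\mathcal T$ such that, for every $u\in S$, the height $\eta_u$ is at most the number of neighbours of $u$ in $S$. If $\mathcal T$ is finite, $\mu_{\mathcal T}$ denotes the uniform probability measure on the set $\mathcal R_{\mathcal T}$ of recurrent configurations. If $\mathcal T$ is infinite, $\mu_{\mathcal T}$ denotes the probability measure on $\{1,2,3\}^{\mathcal T}$ that is the weak limit of the measures $\mu_{\mathcal T'}$ along the net of finite subtrees $\mathcal T'\subset\mathcal T$ ordered by inclusion, i.e. $\mu_{\mathcal T}(\eta_w=\xi_w\ \forall w\in W)=\lim_{\mathcal T'\uparrow\mathcal T}\mu_{\mathcal T'}(\eta_w=\xi_w\ \forall w\in W)$ for every finite $W\subset\mathcal T$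 and every $\xi\in\{1,2,3\}^{\mathcal T}$. Put $$\mathrm{Cov}(u,v,\mathcal T)=\int\eta_u\eta_v\,\mu_{\mathcal T}(d\eta)-\int\eta_u\,\mu_{\mathcal T}(d\eta)\int\eta_v\,\mu_{\mathcal T}(d\eta),\qquad u,v\in\mathcal T .$$ **Theorem 6.1.** For every finite or infinite subtree $\mathcal T$ of $\mathcal B$ the measure $\mu_{\mathcal T}$ exists and is unique. With $\gamma=\frac{4}{25}\,2^{32/25}\approx 0.389$, there is a constant $C$ such that, for every subtree $\mathcal T$ of $\mathcal B$ and all $u,v\in\mathcal T$ at mutual distance $n\ge 0$, $$|\mathrm{Cov}(u,v,\mathcal T)|\le C\gamma^n .$$ In particular the covariances are absolutely summable, uniformly in the subtree: there is a constant $K$ such that, for every subtree $\mathcal T$ of $\mathcal B$ and every $u\in\mathcal T$, $$\sum_{v\in\mathcal T}|\mathrm{Cov}(u,v,\mathcal T)|\le K .$$ -/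

import Mathlib

open Filter Topology MeasureTheory

namespace Sandpile

noncomputable section

/-- Vertices of the Bethe lattice (the rootless full binary tree): a side, telling in which of the
two copies of the rooted infinite binary tree the vertex lies, and the address of the vertex in that
copy (`[]` is the root, and the two children of `l` are `false :: l` and `true :: l`). -/
abbrev Vertex : Type := Bool × List Bool

/-- The Bethe lattice: two rooted infinite binary trees whose roots are joined by a single edge.
The rooted full binary tree is the subtree of all vertices with a given first coordinate. -/
def bethe : SimpleGraph Vertex :=
  SimpleGraph.fromRel fun x y =>
    (x.1 = y.1 ∧ ∃ b : Bool, y.2 = b :: x.2) ∨ (x.1 ≠ y.1 ∧ x.2 = [] ∧ y.2 = [])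

/-- A (finite or infinite) subtree, given by its vertex set: the induced graph is connected, and in
particular nonempty. It is acyclic because `bethe` is; and every subgraph of `bethe` that is a tree
is the one induced on its vertex set. -/
def IsSubtree (T : Set Vertex) : Prop := (bethe.induce T).Connected

/-- The heights of a stable configuration. -/
abbrev Height : Type := ↥(Finset.Icc (1 : ℕ) 3)

/-- Stable height configurations on `T`. -/
abbrev Config (T : Set Vertex) : Type := T → Height

/-- The restriction of `η` to the finite nonempty set `S` of vertices of `T` is a forbidden
subconfiguration: the height at every `u ∈ S` is at most the number of neighbours of `u` in `S`. -/
def IsForbidden {T : Set Vertex} (η : Config T) (S : Finset T) : Prop :=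
  S.Nonempty ∧ ∀ u ∈ S, (η u : ℕ) ≤ {w : T | w ∈ S ∧ (bethe.induce T).Adj u w}.ncard

/-- Recurrent (equivalently, allowed) configurations: the stable configurations without a forbidden
subconfiguration. -/
def recurrent (T : Set Vertex) : Set (Config T) :=
  {η | ∀ S : Finset T, ¬ IsForbidden η S}

/-- The finite subtrees of `T`, a net under inclusion. -/
abbrev FiniteSubtree (T : Set Vertex) : Type :=
  {T' : Set Vertex // IsSubtree T' ∧ T'.Finite ∧ T' ⊆ T}

/-- The configurations on `T'` that agree with `ξ` at all vertices of `W` lying in `T'`. -/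
def cylinder {T : Set Vertex} (W : Finset T) (ξ : Config T) (T' : Set Vertex) : Set (Config T') :=
  {η | ∀ w ∈ W, ∀ h : (w : Vertex) ∈ T', η ⟨w, h⟩ = ξ w}

/-- `μ` is the uniform measure on the recurrent configurations of `T`. For finite `T` this is meant
literally; for infinite `T` it is the probability measure whose cylinder probabilities are the limits
of those of the uniform measures on the recurrent configurations of `T'`, along the net of the finite
subtrees `T'` of `T` (the weak limit of these measures). -/
def IsUniformRecurrent (T : Set Vertex) (μ : Measure (Config T)) : Prop :=
  (T.Finite → μ = ProbabilityTheory.uniformOn (recurrent T)) ∧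
  (T.Infinite → IsProbabilityMeasure μ ∧
    ∀ (W : Finset T) (ξ : Config T),
      Tendsto
        (fun T' : FiniteSubtree T =>
          (ProbabilityTheory.uniformOn (recurrent T'.1)).real (cylinder W ξ T'.1))
        atTop (𝓝 (μ.real (cylinder W ξ T))))

/-- The covariance of the heights at `u` and `v` under `μ`. -/
def heightCov {T : Set Vertex} (μ : Measure (Config T)) (u v : T) : ℝ :=
  (∫ η, ((η u : ℕ) : ℝ) * ((η v : ℕ) : ℝ) ∂μ)
    - (∫ η, ((η u : ℕ) : ℝ) ∂μ) * (∫ η, ((η v : ℕ) : ℝ) ∂μ)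

/-- The decay rate `γ = (4/25) · 2^(32/25) ≈ 0.389`. -/
def decayRate : ℝ := (4 / 25) * (2 : ℝ) ^ ((32 : ℝ) / 25)

end

end Sandpile

/-! Let `l` be a leaf of a finite tree, attached at `p`. With height 2 or 3 it lies in no forbidden
set; with height 1 its presence has the same effect as lowering the height at `p` by one. A sum over
recurrent configurations with single-site weights thus reduces to one over the tree without `l`, the
weight at `p` being replaced by a combination of itself and its shift (`pf_insert`). By iteration,
everything outside a finite subtree `T₀` enters, up to a common factor, only through one number per
branch leaving `T₀`: the ratio `x` of weakly to strongly recurrent configurations on that branch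
(`exists_pf_eq_mul_pf`). It obeys `x = (1 + a)(1 + b) / (2 + a + b)`, where `a`, `b` belong to the
two sub-branches, and it is 0 for an empty branch.

The ratios increase with the tree and stay at most 1; along the finite subtrees of `T` they converge
to the least solution of the recursion on `T` (`tendsto_eBranchRatio`). So the cylinder
probabilities converge. Compactness then provides a limit measure, and its cylinder probabilities
determine it.

For covariances, `T₀` is the path from `u` to `v`. An interior vertex has at most one branch off the
path, hence weights `1 + x, 1 + x, 1` at heights 1, 2, 3, with `0 ≤ x ≤ 1`. Summing out the path
from the end `u` acts on the pair `(f 2 + f 3, f 1)` by a 2×2 matrix of determinant `(1 + x)²`,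
while `f 2 + f 3 + f 1 / 2` grows at least by the factor `2(1 + x)`. The covariance of two height
indicators is a 2×2 determinant of partition functions divided by the square of one, so each step
gains a factor 1/4 (`pathPf_det_le`). This is better than `decayRate`; as at most `3 ^ n` vertices
lie at distance `n` and `3/4 < 1`, it also gives summability. -/

namespace Sandpile

noncomputable section

/-! ### The Bethe lattice -/

/-- The three neighbours of a vertex of the Bethe lattice. -/
def nbrs : Vertex → Finset Vertex
  | (s, []) => {(!s, []), (s, [false]), (s, [true])}
  | (s, b :: l) => {(s, l), (s, false :: b :: l), (s, true :: b :: l)}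

theorem mem_nbrs {p q : Vertex} : q ∈ nbrs p ↔ bethe.Adj p q := by
  obtain ⟨s, l⟩ := p
  obtain ⟨t, m⟩ := q
  cases l with
  | nil =>
    simp only [nbrs, bethe, SimpleGraph.fromRel_adj, Finset.mem_insert, Finset.mem_singleton,
      Prod.mk.injEq]
    cases s <;> cases t <;> cases m <;> simp [eq_comm, ← or_and_right]
  | cons b l =>
    simp only [nbrs, bethe, SimpleGraph.fromRel_adj, Finset.mem_insert, Finset.mem_singleton,
      Prod.mk.injEq]
    constructor
    · rintro (⟨rfl, rfl⟩ | ⟨rfl, rfl⟩ | ⟨rfl, rfl⟩)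
      · exact ⟨by simp, Or.inr (Or.inl ⟨rfl, b, rfl⟩)⟩
      · exact ⟨by simp, Or.inl (Or.inl ⟨rfl, _, rfl⟩)⟩
      · exact ⟨by simp, Or.inl (Or.inl ⟨rfl, _, rfl⟩)⟩
    · rintro ⟨-, (⟨rfl, c, rfl⟩ | ⟨-, h, -⟩) | (⟨rfl, c, h⟩ | ⟨-, -, h⟩)⟩
      · cases c <;> simp
      · simp at h
      · simp only [List.cons.injEq] at h
        simp [h.2]
      · simp at h

theorem card_nbrs (p : Vertex) : (nbrs p).card = 3 := by
  obtain ⟨s, l⟩ := p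
  cases l with
  | nil => cases s <;> decide
  | cons b l =>
    have h : l ≠ false :: b :: l ∧ l ≠ true :: b :: l := by
      constructor <;> intro h <;> have := congrArg List.length h <;>
        simp only [List.length_cons] at this <;> omega
    simp [nbrs, Finset.card_insert_of_notMem, h.1, h.2]

theorem mem_nbrs_comm {p q : Vertex} : q ∈ nbrs p ↔ p ∈ nbrs q := by
  rw [mem_nbrs, mem_nbrs, SimpleGraph.adj_comm]

theorem notMem_nbrs_self (p : Vertex) : p ∉ nbrs p := by
  simp [mem_nbrs]

theorem bethe_isAcyclic : bethe.IsAcyclic := by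
  -- an edge is a bridge because the descendants of its lower end form a component after its removal
  have down : ∀ (s b : Bool) (l : List Bool), bethe.IsBridge s((s, l), (s, b :: l)) := by
    intro s b l
    rw [SimpleGraph.isBridge_iff]
    intro h
    have hstep : ∀ x y : Vertex, (bethe \ SimpleGraph.fromEdgeSet {s((s, l), (s, b :: l))}).Adj x y →
        (y.1 = s ∧ (b :: l) <:+ y.2) → (x.1 = s ∧ (b :: l) <:+ x.2) := by
      rintro ⟨t, m⟩ ⟨t', m'⟩ hadj ⟨rfl, hs⟩
      simp only at hs
      rw [SimpleGraph.sdiff_adj, SimpleGraph.fromEdgeSet_adj] at hadj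
      obtain ⟨h1, h2⟩ := hadj
      simp only [bethe, SimpleGraph.fromRel_adj] at h1
      obtain ⟨hne, (⟨rfl, c, rfl⟩ | ⟨-, -, rfl⟩) | (⟨rfl, c, rfl⟩ | ⟨-, rfl, -⟩)⟩ := h1
      · rw [List.suffix_cons_iff] at hs
        rcases hs with hs | hs
        · exfalso
          apply h2
          simp only [List.cons.injEq] at hs
          obtain ⟨rfl, rfl⟩ := hs
          exact ⟨by simp, hne⟩
        · exact ⟨rfl, hs⟩
      · simp at hs
      · exact ⟨rfl, hs.trans (List.suffix_cons _ _)⟩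
      · simp at hs
    obtain ⟨w⟩ := h
    have : ∀ {x y : Vertex} (w : (bethe \ SimpleGraph.fromEdgeSet {s((s, l), (s, b :: l))}).Walk x y),
        (y.1 = s ∧ (b :: l) <:+ y.2) → (x.1 = s ∧ (b :: l) <:+ x.2) := by
      intro x y w
      induction w with
      | nil => exact id
      | cons hadj _ ih => exact fun hy => hstep _ _ hadj (ih hy)
    have h2 := (this w ⟨rfl, List.suffix_refl _⟩).2.length_le
    simp at h2
  -- Without the edge between the two roots, the side is constant along every walk.
  have root : ∀ s t : Bool, s ≠ t → bethe.IsBridge s((s, []), (t, [])) := by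
    intro s t hst
    rw [SimpleGraph.isBridge_iff]
    rintro ⟨w⟩
    have : ∀ {x y : Vertex} (w : (bethe \ SimpleGraph.fromEdgeSet {s((s, []), (t, []))}).Walk x y),
        x.1 = y.1 := by
      intro x y w
      induction w with
      | nil => rfl
      | @cons a b c hadj _ ih =>
        refine Eq.trans ?_ ih
        by_contra hne
        rw [SimpleGraph.sdiff_adj, SimpleGraph.fromEdgeSet_adj] at hadj
        obtain ⟨h1, h2⟩ := hadj
        obtain ⟨a1, a2⟩ := a
        obtain ⟨b1, b2⟩ := b
        simp only [bethe, SimpleGraph.fromRel_adj] at h1 hne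
        obtain ⟨hne', (⟨h, -⟩ | ⟨-, rfl, rfl⟩) | (⟨h, -⟩ | ⟨-, rfl, rfl⟩)⟩ := h1
        · exact hne h
        · apply h2
          refine ⟨?_, hne'⟩
          rw [Set.mem_singleton_iff, Sym2.eq_iff]
          revert hst hne
          clear * -
          cases a1 <;> cases b1 <;> cases s <;> cases t <;> simp
        · exact hne h.symm
        · apply h2
          refine ⟨?_, hne'⟩
          rw [Set.mem_singleton_iff, Sym2.eq_iff]
          revert hst hne
          clear * -
          cases a1 <;> cases b1 <;> cases s <;> cases t <;> simp
    exact hst (this w)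
  rw [SimpleGraph.isAcyclic_iff_forall_adj_isBridge]
  rintro ⟨s, l⟩ ⟨t, m⟩ h
  simp only [bethe, SimpleGraph.fromRel_adj] at h
  obtain ⟨-, (⟨rfl, c, rfl⟩ | ⟨hst, rfl, rfl⟩) | (⟨rfl, c, rfl⟩ | ⟨hst, rfl, rfl⟩)⟩ := h
  · exact down _ _ _
  · exact root _ _ hst
  · rw [Sym2.eq_swap]
    exact down _ _ _
  · exact root _ _ (Ne.symm hst)

/-- A vertex outside a subtree has at most one neighbour in it. -/
theorem IsSubtree.eq_of_adj {T : Set Vertex} (hT : IsSubtree T) {l p q : Vertex} (hl : l ∉ T)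
    (hp : p ∈ T) (hq : q ∈ T) (hlp : bethe.Adj l p) (hlq : bethe.Adj l q) : p = q := by
  by_contra hne
  obtain ⟨w, hw⟩ := (hT.preconnected ⟨p, hp⟩ ⟨q, hq⟩).exists_isPath
  let w' := w.map (SimpleGraph.Embedding.induce T).toHom
  have hw' : w'.IsPath := hw.map (SimpleGraph.Embedding.induce (G := bethe) T).injective
  have hsup : ∀ x ∈ w'.support, x ∈ T := by
    intro x hx
    simp only [w', SimpleGraph.Walk.support_map, List.mem_map] at hx
    obtain ⟨y, -, rfl⟩ := hx
    exact y.2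
  let c : bethe.Walk p q := SimpleGraph.Walk.cons hlp.symm (SimpleGraph.Walk.cons hlq .nil)
  have hc : c.IsPath := by
    simp only [c, SimpleGraph.Walk.cons_isPath_iff, SimpleGraph.Walk.IsPath.nil,
      SimpleGraph.Walk.support_cons, SimpleGraph.Walk.support_nil, true_and]
    have := hlp.ne
    have := hlq.ne
    simp_all [eq_comm]
  have h : (⟨w', hw'⟩ : bethe.Path p q) = ⟨c, hc⟩ :=
    (bethe_isAcyclic.subsingleton_path p q).elim _ _
  have h' : w' = c := congrArg Subtype.val h
  apply hl
  apply hsup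
  rw [h']
  simp [c]

/-! ### Recurrent configurations and weighted partition functions -/

/-- The heights `h` contain no forbidden subconfiguration inside the finite set `T`. -/
def IsRec (T : Finset Vertex) (h : Vertex → ℕ) : Prop :=
  ∀ S ⊆ T, S.Nonempty → ∃ u ∈ S, (nbrs u ∩ S).card < h u

theorem IsRec.mono_set {T T' : Finset Vertex} {h : Vertex → ℕ} (hr : IsRec T' h) (hT : T ⊆ T') :
    IsRec T h := fun S hS hne => hr S (hS.trans hT) hne

theorem isRec_congr {T : Finset Vertex} {h h' : Vertex → ℕ} (hh : ∀ q ∈ T, h q = h' q) :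
    IsRec T h ↔ IsRec T h' := by
  refine forall_congr' fun S => forall_congr' fun hS => forall_congr' fun _ => ?_
  refine exists_congr fun u => and_congr_right fun hu => ?_
  rw [hh u (hS hu)]

theorem IsRec.pos {T : Finset Vertex} {h : Vertex → ℕ} (hr : IsRec T h) {p : Vertex} (hp : p ∈ T) :
    0 < h p := by
  obtain ⟨u, hu, hlt⟩ := hr {p} (by simpa using hp) (by simp)
  rw [Finset.mem_singleton] at hu
  subst hu
  omega

/-- A leaf has at most one neighbour in any set, so with height at least 2 it belongs to no
forbidden set. -/
theorem isRec_insert_of_two_le {T : Finset Vertex} {h : Vertex → ℕ} {l p : Vertex}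
    (hN : nbrs l ∩ T = {p}) (h2 : 2 ≤ h l) : IsRec (insert l T) h ↔ IsRec T h := by
  refine ⟨fun hr => hr.mono_set (Finset.subset_insert _ _), fun hr S hS hne => ?_⟩
  by_cases hlS : l ∈ S
  · refine ⟨l, hlS, ?_⟩
    have hsub : nbrs l ∩ S ⊆ {p} := by
      rw [← hN]
      intro x hx
      rw [Finset.mem_inter] at hx ⊢
      refine ⟨hx.1, (Finset.mem_insert.1 (hS hx.2)).resolve_left ?_⟩
      rintro rfl
      exact notMem_nbrs_self _ hx.1
    have := Finset.card_le_card hsub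
    rw [Finset.card_singleton] at this
    omega
  · exact hr S ((Finset.subset_insert_iff_of_notMem hlS).1 hS) hne

/-- A leaf of height 1 may be added to any forbidden set containing `p`. This raises the neighbour
count of `p` by one and changes no other count, which amounts to lowering the height at `p`. -/
theorem isRec_insert_of_eq_one {T : Finset Vertex} {h : Vertex → ℕ} {l p : Vertex} (hl : l ∉ T)
    (hN : nbrs l ∩ T = {p}) (h1 : h l = 1) :
    IsRec (insert l T) h ↔ IsRec T (Function.update h p (h p - 1)) := by
  have hp : p ∈ nbrs l ∩ T := by simp [hN]
  rw [Finset.mem_inter] at hp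
  have hlp : l ∈ nbrs p := mem_nbrs_comm.1 hp.1
  have hcard : ∀ u ∈ T, u ≠ p → ∀ S : Finset Vertex, nbrs u ∩ insert l S = nbrs u ∩ S := by
    intro u hu hup S
    refine Finset.inter_insert_of_notMem fun hlu => hup ?_
    have : u ∈ nbrs l ∩ T := Finset.mem_inter.2 ⟨mem_nbrs_comm.1 hlu, hu⟩
    simpa [hN] using this
  have hcardp : ∀ S : Finset Vertex, l ∉ S → (nbrs p ∩ insert l S).card = (nbrs p ∩ S).card + 1 := by
    intro S hS
    rw [Finset.inter_insert_of_mem hlp, Finset.card_insert_of_notMem]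
    simp [hS]
  constructor
  · intro hr S hS hne
    have hlS : l ∉ S := fun h => hl (hS h)
    by_cases hpS : p ∈ S
    · obtain ⟨u, hu, hlt⟩ := hr (insert l S) (Finset.insert_subset_insert _ hS) (by simp)
      rcases Finset.mem_insert.1 hu with rfl | hu
      · exfalso
        have : 0 < (nbrs u ∩ insert u S).card :=
          Finset.card_pos.2 ⟨p, Finset.mem_inter.2 ⟨hp.1, Finset.mem_insert_of_mem hpS⟩⟩
        omega
      · refine ⟨u, hu, ?_⟩
        by_cases hup : u = p
        · subst hup
          rw [hcardp S hlS] at hlt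
          rw [Function.update_self]
          omega
        · rwa [Function.update_of_ne hup, ← hcard u (hS hu) hup]
    · obtain ⟨u, hu, hlt⟩ := hr S (hS.trans (Finset.subset_insert _ _)) hne
      refine ⟨u, hu, ?_⟩
      rwa [Function.update_of_ne]
      rintro rfl
      exact hpS hu
  · intro hr S hS hne
    by_cases hlS : l ∈ S
    · by_cases hpS : p ∈ S
      · have hpl : p ≠ l := fun h => hl (h ▸ hp.2)
        have hsub : S.erase l ⊆ T := Finset.subset_insert_iff.1 hS
        obtain ⟨u, hu, hlt⟩ := hr (S.erase l) hsub ⟨p, Finset.mem_erase.2 ⟨hpl, hpS⟩⟩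
        refine ⟨u, Finset.mem_of_mem_erase hu, ?_⟩
        rw [← Finset.insert_erase hlS]
        by_cases hup : u = p
        · subst hup
          rw [Function.update_self] at hlt
          rw [hcardp _ (Finset.notMem_erase _ _)]
          omega
        · rw [Function.update_of_ne hup] at hlt
          rwa [hcard u (hsub hu) hup]
      -- Without `p`, the leaf has no neighbour in `S`, and its height 1 exceeds 0.
      · refine ⟨l, hlS, ?_⟩
        rw [h1, Nat.lt_one_iff, Finset.card_eq_zero, Finset.eq_empty_iff_forall_notMem]
        intro x hx
        rw [Finset.mem_inter] at hx
        rcases Finset.mem_insert.1 (hS hx.2) with rfl | hxT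
        · exact notMem_nbrs_self _ hx.1
        · have : x ∈ nbrs l ∩ T := Finset.mem_inter.2 ⟨hx.1, hxT⟩
          rw [hN, Finset.mem_singleton] at this
          exact hpS (this ▸ hx.2)
    · obtain ⟨u, hu, hlt⟩ := hr S ((Finset.subset_insert_iff_of_notMem hlS).1 hS) hne
      refine ⟨u, hu, hlt.trans_le ?_⟩
      by_cases hup : u = p
      · subst hup
        rw [Function.update_self]
        omega
      · rw [Function.update_of_ne hup]

/-- The stable height functions on `T`, extended by zero. -/
def confs (T : Finset Vertex) : Finset (Vertex →₀ ℕ) := T.finsupp fun _ => Finset.Icc 1 3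

theorem mem_confs {T : Finset Vertex} {h : Vertex →₀ ℕ} :
    h ∈ confs T ↔ h.support ⊆ T ∧ ∀ q ∈ T, h q ∈ Finset.Icc 1 3 := Finset.mem_finsupp_iff

theorem sum_confs_insert {T : Finset Vertex} {l : Vertex} (hl : l ∉ T) (F : (Vertex → ℕ) → ℝ) :
    ∑ h ∈ confs (insert l T), F h =
      ∑ h ∈ confs T, ∑ a ∈ Finset.Icc 1 3, F (Function.update h l a) := by
  rw [← Finset.sum_product']
  refine Finset.sum_bij' (fun h _ => (h.erase l, h l)) (fun x _ => x.1.update l x.2) ?_ ?_ ?_ ?_ ?_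
  · intro h hh
    rw [mem_confs] at hh
    rw [Finset.mem_product, mem_confs]
    refine ⟨⟨?_, fun q hq => ?_⟩, hh.2 l (Finset.mem_insert_self _ _)⟩
    · rw [Finsupp.support_erase]
      exact (Finset.erase_subset_erase _ hh.1).trans (by rw [Finset.erase_insert hl])
    · rw [Finsupp.erase_ne (by rintro rfl; exact hl hq)]
      exact hh.2 q (Finset.mem_insert_of_mem hq)
  · rintro ⟨h, a⟩ hx
    rw [Finset.mem_product, mem_confs] at hx
    rw [mem_confs]
    refine ⟨?_, fun q hq => ?_⟩
    · exact (Finsupp.support_update_subset _ _).trans (Finset.insert_subset_insert _ hx.1.1)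
    · rw [Finsupp.coe_update]
      by_cases hql : q = l
      · subst hql
        rw [Function.update_self]
        exact hx.2
      · rw [Function.update_of_ne hql]
        exact hx.1.2 q ((Finset.mem_insert.1 hq).resolve_left hql)
  · intro h hh
    ext q
    by_cases hql : q = l <;> simp [hql]
  · rintro ⟨h, a⟩ hx
    rw [Finset.mem_product, mem_confs] at hx
    -- Extension by zero off `T` is what makes erasing at `l` undo the update.
    have h0 : h l = 0 := by
      by_contra h0
      exact hl (hx.1.1 (Finsupp.mem_support_iff.2 h0))
    refine Prod.ext ?_ (by simp)
    ext q
    by_cases hql : q = l <;> simp [hql, h0]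
  · intro h hh
    congr 1
    ext q
    by_cases hql : q = l <;> simp [hql]

open Classical in
/-- The partition function of the recurrent configurations on `T` with the single-site weights
`W`. -/
def pf (T : Finset Vertex) (W : Vertex → ℕ → ℝ) : ℝ :=
  ∑ h ∈ confs T, if IsRec T h then ∏ q ∈ T, W q (h q) else 0

theorem pf_congr {T : Finset Vertex} {W W' : Vertex → ℕ → ℝ} (h : ∀ q ∈ T, W q = W' q) :
    pf T W = pf T W' := by
  refine Finset.sum_congr rfl fun c _ => ?_
  rw [Finset.prod_congr rfl fun q hq => by rw [h q hq]]

theorem prod_update_apply {T : Finset Vertex} {p : Vertex} (hp : p ∈ T) (W : Vertex → ℕ → ℝ)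
    (g : ℕ → ℝ) (h : Vertex → ℕ) :
    ∏ q ∈ T, Function.update W p g q (h q) = g (h p) * ∏ q ∈ T.erase p, W q (h q) := by
  rw [← Finset.mul_prod_erase T _ hp, Function.update_self]
  congr 1
  refine Finset.prod_congr rfl fun q hq => ?_
  rw [Function.update_of_ne (Finset.ne_of_mem_erase hq)]

theorem pf_update_const_mul {T : Finset Vertex} {p : Vertex} (hp : p ∈ T) (W : Vertex → ℕ → ℝ)
    (c : ℝ) (g : ℕ → ℝ) :
    pf T (Function.update W p fun k => c * g k) = c * pf T (Function.update W p g) := by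
  rw [pf, pf, Finset.mul_sum]
  refine Finset.sum_congr rfl fun h _ => ?_
  rw [prod_update_apply hp, prod_update_apply hp, mul_ite, mul_zero, mul_assoc]

theorem sum_Icc_one_three (f : ℕ → ℝ) : ∑ a ∈ Finset.Icc 1 3, f a = f 1 + f 2 + f 3 := by
  rw [show Finset.Icc 1 3 = {1, 2, 3} from rfl]
  simp [add_assoc]

-- The substitution `k ↦ k + 1` for the height at `p`. The ends match: height 0 is never recurrent,
-- and the new top term carries `g 4 = 0`.
open Classical in
theorem sum_confs_shift {T : Finset Vertex} {p : Vertex} (hp : p ∈ T) (g : ℕ → ℝ) (hg : g 4 = 0)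
    (W : Vertex → ℕ → ℝ) :
    (∑ h ∈ confs T, if IsRec T (Function.update h p (h p - 1)) then
        g (h p) * ∏ q ∈ T.erase p, W q (h q) else 0) =
      ∑ h ∈ confs T, if IsRec T h then g (h p + 1) * ∏ q ∈ T.erase p, W q (h q) else 0 := by
  obtain ⟨T, hpT, rfl⟩ : ∃ T', p ∉ T' ∧ T = insert p T' :=
    ⟨T.erase p, Finset.notMem_erase _ _, (Finset.insert_erase hp).symm⟩
  rw [sum_confs_insert hpT fun h => if IsRec (insert p T) (Function.update h p (h p - 1)) then
        g (h p) * ∏ q ∈ (insert p T).erase p, W q (h q) else 0,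
    sum_confs_insert hpT fun h => if IsRec (insert p T) h then
        g (h p + 1) * ∏ q ∈ (insert p T).erase p, W q (h q) else 0]
  refine Finset.sum_congr rfl fun h _ => ?_
  have hprod : ∀ a, ∏ q ∈ (insert p T).erase p, W q (Function.update h p a q) =
      ∏ q ∈ (insert p T).erase p, W q (h q) := fun a =>
    Finset.prod_congr rfl fun q hq => by rw [Function.update_of_ne (Finset.ne_of_mem_erase hq)]
  have h0 : ¬ IsRec (insert p T) (Function.update h p 0) := fun hr => by
    have := hr.pos (Finset.mem_insert_self p T)
    simp at this
  simp only [hprod, sum_Icc_one_three]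
  simp [h0, hg]

/-- The transfer step: heights 2 and 3 at the leaf leave the rest alone, and height 1 shifts the
weight at `p`. -/
theorem pf_insert {T : Finset Vertex} {l p : Vertex} (hl : l ∉ T) (hN : nbrs l ∩ T = {p})
    (W : Vertex → ℕ → ℝ) (hW : W p 4 = 0) :
    pf (insert l T) W = pf T (Function.update W p fun k =>
      (W l 2 + W l 3) * W p k + W l 1 * W p (k + 1)) := by
  classical
  have hp : p ∈ nbrs l ∩ T := by simp [hN]
  rw [Finset.mem_inter] at hp
  have hpl : p ≠ l := fun h => hl (h ▸ hp.2)
  rw [pf, sum_confs_insert hl fun h => if IsRec (insert l T) h then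
        ∏ q ∈ insert l T, W q (h q) else 0]
  have key : ∀ h : Vertex →₀ ℕ, (∑ a ∈ Finset.Icc 1 3,
      if IsRec (insert l T) (Function.update h l a) then
        ∏ q ∈ insert l T, W q (Function.update h l a q) else 0) =
      (W l 2 + W l 3) * (if IsRec T h then W p (h p) * ∏ q ∈ T.erase p, W q (h q) else 0) +
      W l 1 * (if IsRec T (Function.update h p (h p - 1)) then
        W p (h p) * ∏ q ∈ T.erase p, W q (h q) else 0) := by
    intro h
    have hprod : ∀ a, ∏ q ∈ insert l T, W q (Function.update h l a q) =
        W l a * (W p (h p) * ∏ q ∈ T.erase p, W q (h q)) := by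
      intro a
      rw [Finset.prod_insert hl, Function.update_self, Finset.mul_prod_erase T (fun q => W q (h q)) hp.2]
      congr 1
      refine Finset.prod_congr rfl fun q hq => ?_
      rw [Function.update_of_ne (by rintro rfl; exact hl hq)]
    have hcongr : ∀ a, IsRec T (Function.update h l a) ↔ IsRec T h := fun a =>
      isRec_congr fun q hq => Function.update_of_ne (by rintro rfl; exact hl hq) _ _
    have h2 : ∀ a, 2 ≤ a → (IsRec (insert l T) (Function.update h l a) ↔ IsRec T h) := by
      intro a ha
      rw [isRec_insert_of_two_le hN (by simpa using ha), hcongr]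
    have h1 : IsRec (insert l T) (Function.update h l 1) ↔
        IsRec T (Function.update h p (h p - 1)) := by
      rw [isRec_insert_of_eq_one hl hN (by simp), Function.update_of_ne hpl,
        Function.update_comm hpl.symm]
      exact isRec_congr fun q hq => Function.update_of_ne (by rintro rfl; exact hl hq) _ _
    rw [sum_Icc_one_three]
    simp only [hprod, h1, h2 2 le_rfl, h2 3 (by norm_num), mul_ite, mul_zero]
    split_ifs <;> ring
  simp only [key]
  rw [Finset.sum_add_distrib, ← Finset.mul_sum, ← Finset.mul_sum,
    sum_confs_shift hp.2 (W p) hW W, pf, Finset.mul_sum, Finset.mul_sum, ← Finset.sum_add_distrib]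
  refine Finset.sum_congr rfl fun h _ => ?_
  rw [prod_update_apply hp.2]
  split_ifs <;> ring

theorem pf_singleton (v : Vertex) (W : Vertex → ℕ → ℝ) : pf {v} W = W v 1 + W v 2 + W v 3 := by
  classical
  have h0 : ∀ a, 1 ≤ a → IsRec (insert v ∅) (Function.update (0 : Vertex →₀ ℕ) v a) := by
    intro a ha S hS hne
    have hS' : S = {v} := (Finset.subset_singleton_iff.1 hS).resolve_left hne.ne_empty
    subst hS'
    refine ⟨v, by simp, ?_⟩
    rw [Finset.inter_singleton_of_notMem (notMem_nbrs_self v)]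
    simpa using Nat.pos_of_ne_zero (by omega)
  have hc : confs ∅ = {0} := by
    ext h
    simp [mem_confs]
  rw [← insert_empty_eq v, pf, sum_confs_insert (Finset.notMem_empty v) fun h =>
    if IsRec (insert v ∅) h then ∏ q ∈ insert v ∅, W q (h q) else 0, hc, Finset.sum_singleton,
    sum_Icc_one_three, if_pos (h0 1 le_rfl), if_pos (h0 2 (by norm_num)),
    if_pos (h0 3 (by norm_num))]
  simp

/-! ### Subtrees -/

theorem isSubtree_singleton (v : Vertex) : IsSubtree {v} := by
  have : Nonempty ({v} : Set Vertex) := ⟨⟨v, rfl⟩⟩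
  refine ⟨fun x y => ?_⟩
  rw [Subsingleton.elim x y]

theorem IsSubtree.insert_of_adj {T : Set Vertex} (hT : IsSubtree T) {l p : Vertex} (hp : p ∈ T)
    (hlp : bethe.Adj l p) : IsSubtree (insert l T) :=
  SimpleGraph.connected_induce_union (isSubtree_singleton l).preconnected hT.preconnected
    rfl hp hlp

theorem IsSubtree.nonempty {T : Set Vertex} (hT : IsSubtree T) : T.Nonempty :=
  Set.nonempty_coe_sort.1 (SimpleGraph.Connected.nonempty hT)

theorem IsSubtree.exists_finite_superset {T : Set Vertex} (hT : IsSubtree T) {W : Finset Vertex}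
    (hne : W.Nonempty) (hW : ↑W ⊆ T) :
    ∃ T' : Finset Vertex, IsSubtree (T' : Set Vertex) ∧ W ⊆ T' ∧ (T' : Set Vertex) ⊆ T := by
  classical
  obtain ⟨w, hw⟩ := hne
  obtain ⟨t, ht, hconn⟩ := SimpleGraph.extend_finset_to_connected hT.preconnected
    (t := W.subtype (· ∈ T)) ⟨⟨w, hW hw⟩, by simpa using hw⟩
  refine ⟨t.map (Function.Embedding.subtype _), ?_, fun x hx => ?_, fun x hx => ?_⟩
  · let f : (bethe.induce T).induce (t : Set T) →g
        bethe.induce ((t.map (Function.Embedding.subtype _) : Finset Vertex) : Set Vertex) :=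
      { toFun := fun x => ⟨x.1.1, by simp⟩
        map_rel' := fun {x y} h => h }
    refine hconn.map f ?_
    rintro ⟨x, hx⟩
    simp only [Finset.coe_map, Function.Embedding.subtype_apply, Set.mem_image,
      Finset.mem_coe] at hx
    obtain ⟨y, hy, rfl⟩ := hx
    exact ⟨⟨y, hy⟩, rfl⟩
  · rw [Finset.mem_map]
    exact ⟨⟨x, hW hx⟩, ht (by simpa using hx), rfl⟩
  · simp only [Finset.coe_map, Function.Embedding.subtype_apply, Set.mem_image] at hx
    obtain ⟨y, -, rfl⟩ := hx
    exact y.2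

theorem exists_adj_of_ssubset {T T' : Set Vertex} (hT : T.Nonempty) (hT' : IsSubtree T')
    (h : T ⊂ T') : ∃ l ∈ T', l ∉ T ∧ ∃ p ∈ T, bethe.Adj l p := by
  obtain ⟨v, hv⟩ := hT
  obtain ⟨u, huT', huT⟩ := Set.exists_of_ssubset h
  obtain ⟨w⟩ := hT'.preconnected ⟨v, h.1 hv⟩ ⟨u, huT'⟩
  obtain ⟨d, -, h1, h2⟩ := w.exists_boundary_dart {x | x.1 ∈ T} hv huT
  exact ⟨d.snd, d.snd.2, h2, d.fst, h1, d.adj.symm⟩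

/-! ### Contribution of the branches hanging at a vertex -/

/-- The weight of the effective height `k` at a vertex with weight `f`, when each branch in `N`
lowers the height by one with relative weight `x`. -/
def absorb (x : Vertex → ℝ) (N : Finset Vertex) (f : ℕ → ℝ) (k : ℕ) : ℝ :=
  ∑ B ∈ N.powerset, (∏ b ∈ B, x b) * f (k + B.card)

theorem absorb_empty (x : Vertex → ℝ) (f : ℕ → ℝ) : absorb x ∅ f = f := by
  ext k
  simp [absorb]

theorem absorb_insert (x : Vertex → ℝ) {N : Finset Vertex} {a : Vertex} (ha : a ∉ N) (f : ℕ → ℝ)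
    (k : ℕ) : absorb x (insert a N) f k = absorb x N f k + x a * absorb x N f (k + 1) := by
  rw [absorb, Finset.sum_powerset_insert ha, absorb, absorb, Finset.mul_sum]
  congr 1
  refine Finset.sum_congr rfl fun B hB => ?_
  have haB : a ∉ B := fun h => ha (Finset.mem_powerset.1 hB h)
  rw [Finset.prod_insert haB, Finset.card_insert_of_notMem haB, mul_assoc]
  congr 3
  ring

theorem absorb_zero_of_le {x : Vertex → ℝ} {N : Finset Vertex} {f : ℕ → ℝ}
    (hf : ∀ k, 4 ≤ k → f k = 0) {k : ℕ} (hk : 4 ≤ k) : absorb x N f k = 0 :=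
  Finset.sum_eq_zero fun B _ => by rw [hf _ (by omega), mul_zero]

theorem absorb_nonneg {x : Vertex → ℝ} (hx : ∀ a, 0 ≤ x a) {N : Finset Vertex} {f : ℕ → ℝ}
    (hf : ∀ k, 0 ≤ f k) (k : ℕ) : 0 ≤ absorb x N f k :=
  Finset.sum_nonneg fun _ _ => mul_nonneg (Finset.prod_nonneg fun a _ => hx a) (hf _)

theorem absorb_mono {x : Vertex → ℝ} (hx : ∀ a, 0 ≤ x a) {N : Finset Vertex} {f g : ℕ → ℝ}
    (hf : ∀ k, f k ≤ g k) (k : ℕ) : absorb x N f k ≤ absorb x N g k :=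
  Finset.sum_le_sum fun _ _ => mul_le_mul_of_nonneg_left (hf _) (Finset.prod_nonneg fun a _ => hx a)

theorem le_absorb {x : Vertex → ℝ} (hx : ∀ a, 0 ≤ x a) {N : Finset Vertex} {f : ℕ → ℝ}
    (hf : ∀ k, 0 ≤ f k) (k : ℕ) : f k ≤ absorb x N f k := by
  have h : (∏ b ∈ ∅, x b) * f (k + (∅ : Finset Vertex).card) ≤ absorb x N f k :=
    Finset.single_le_sum (f := fun B : Finset Vertex => (∏ b ∈ B, x b) * f (k + B.card))
      (fun B _ => mul_nonneg (Finset.prod_nonneg fun a _ => hx a) (hf _)) (Finset.empty_mem_powerset _)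
  simpa using h

theorem absorb_of_eq_zero {x : Vertex → ℝ} {N : Finset Vertex} (hx : ∀ a ∈ N, x a = 0)
    (f : ℕ → ℝ) : absorb x N f = f := by
  induction N using Finset.induction_on with
  | empty => exact absorb_empty x f
  | insert a N ha ih =>
    ext k
    rw [absorb_insert x ha, hx a (Finset.mem_insert_self _ _),
      ih fun b hb => hx b (Finset.mem_insert_of_mem hb)]
    ring

/-- The weight one on the heights `1, 2, 3`. -/
def unitWeight (k : ℕ) : ℝ := if k ≤ 3 then 1 else 0

theorem unitWeight_nonneg (k : ℕ) : 0 ≤ unitWeight k := by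
  unfold unitWeight
  split_ifs <;> norm_num

theorem unitWeight_zero_of_le {k : ℕ} (hk : 4 ≤ k) : unitWeight k = 0 := if_neg (by omega)

/-! ### The ratio of weak to strong configurations on a branch -/

open Classical in
/-- The recursion for the ratio of weakly to strongly recurrent configurations on the branches of
`T`; the branch indexed by `p, q` starts at `q` and leads away from `p`. -/
def branchStep (T : Set Vertex) :
    (Vertex → Vertex → ENNReal) →o (Vertex → Vertex → ENNReal) where
  -- Values in `ENNReal` form a complete lattice, so one least fixed point covers finite and
  -- infinite `T` alike.
  toFun X p q := if q ∈ T then (∑ a ∈ (nbrs q).erase p, (1 + X q a)⁻¹)⁻¹ else 0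
  monotone' X Y h p q := by
    dsimp only
    split_ifs
    · refine ENNReal.inv_le_inv.2 (Finset.sum_le_sum fun a _ => ENNReal.inv_le_inv.2 ?_)
      gcongr
      exact h q a
    · exact le_rfl

/-- The ratio of weakly to strongly recurrent configurations on a branch, as an extended number. -/
def eBranchRatio (T : Set Vertex) : Vertex → Vertex → ENNReal := (branchStep T).lfp

theorem eBranchRatio_of_mem {T : Set Vertex} (p : Vertex) {q : Vertex} (hq : q ∈ T) :
    eBranchRatio T p q = (∑ a ∈ (nbrs q).erase p, (1 + eBranchRatio T q a)⁻¹)⁻¹ := by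
  have h := congrFun (congrFun (branchStep T).map_lfp p) q
  rw [← eBranchRatio] at h
  rw [← h]
  exact if_pos hq

theorem eBranchRatio_of_notMem {T : Set Vertex} (p : Vertex) {q : Vertex} (hq : q ∉ T) :
    eBranchRatio T p q = 0 := by
  have h := congrFun (congrFun (branchStep T).map_lfp p) q
  rw [← eBranchRatio] at h
  rw [← h]
  exact if_neg hq

/-- The constant 1 is a pre-fixed point: at least two sub-branches contribute 1/2 each to the sum
being inverted. -/
theorem eBranchRatio_le_one (T : Set Vertex) (p q : Vertex) : eBranchRatio T p q ≤ 1 := by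
  classical
  have h : (branchStep T).lfp ≤ fun _ _ => 1 := by
    refine OrderHom.lfp_le _ fun p q => ?_
    change (if q ∈ T then (∑ a ∈ (nbrs q).erase p, (1 + 1 : ENNReal)⁻¹)⁻¹ else 0) ≤ 1
    split_ifs
    · rw [ENNReal.inv_le_one, Finset.sum_const, nsmul_eq_mul, one_add_one_eq_two]
      have : 2 ≤ ((nbrs q).erase p).card := by
        have := Finset.pred_card_le_card_erase (s := nbrs q) (a := p)
        rw [card_nbrs] at this
        exact this
      calc (1 : ENNReal) = 2 * 2⁻¹ := (ENNReal.mul_inv_cancel (by simp) (by simp)).symm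
        _ ≤ _ := by gcongr; exact_mod_cast this
    · exact zero_le
  exact h p q

/-- The solution for `T'` is a pre-fixed point of the recursion for `T`. -/
theorem eBranchRatio_mono {T T' : Set Vertex} (h : T ⊆ T') : eBranchRatio T ≤ eBranchRatio T' := by
  classical
  refine OrderHom.lfp_le _ fun p q => ?_
  change (if q ∈ T then (∑ a ∈ (nbrs q).erase p, (1 + eBranchRatio T' q a)⁻¹)⁻¹ else 0) ≤ _
  split_ifs with hq
  · rw [eBranchRatio_of_mem p (h hq)]
  · exact zero_le

/-- The ratio of weakly to strongly recurrent configurations on a branch. -/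
def branchRatio (T : Set Vertex) (p q : Vertex) : ℝ := (eBranchRatio T p q).toReal

theorem branchRatio_nonneg (T : Set Vertex) (p q : Vertex) : 0 ≤ branchRatio T p q :=
  ENNReal.toReal_nonneg

theorem branchRatio_le_one (T : Set Vertex) (p q : Vertex) : branchRatio T p q ≤ 1 :=
  ENNReal.toReal_le_of_le_ofReal zero_le_one (by simpa using eBranchRatio_le_one T p q)

theorem branchRatio_of_notMem {T : Set Vertex} (p : Vertex) {q : Vertex} (hq : q ∉ T) :
    branchRatio T p q = 0 := by
  rw [branchRatio, eBranchRatio_of_notMem p hq, ENNReal.toReal_zero]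

theorem branchRatio_eq {T : Set Vertex} {p q a b : Vertex} (hq : q ∈ T) (hab : a ≠ b)
    (hN : (nbrs q).erase p = {a, b}) :
    branchRatio T p q * (2 + branchRatio T q a + branchRatio T q b) =
      (1 + branchRatio T q a) * (1 + branchRatio T q b) := by
  have ha := ((eBranchRatio_le_one T q a).trans_lt ENNReal.one_lt_top).ne
  have hb := ((eBranchRatio_le_one T q b).trans_lt ENNReal.one_lt_top).ne
  have ha' := branchRatio_nonneg T q a
  have hb' := branchRatio_nonneg T q b
  have h : branchRatio T p q =
      ((1 + branchRatio T q a)⁻¹ + (1 + branchRatio T q b)⁻¹)⁻¹ := by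
    rw [branchRatio, eBranchRatio_of_mem p hq, hN, Finset.sum_pair hab, ENNReal.toReal_inv,
      ENNReal.toReal_add (by simp) (by simp), ENNReal.toReal_inv, ENNReal.toReal_inv,
      ENNReal.toReal_add (by simp) ha, ENNReal.toReal_add (by simp) hb, ENNReal.toReal_one]
    rfl
  rw [h]
  field_simp
  ring

/-! ### Reduction to a smaller subtree -/

/-- The single-site weights on `T` after the branches outside `T` have been summed out. -/
def effWeight (x : Vertex → Vertex → ℝ) (T : Finset Vertex) (f : Vertex → ℕ → ℝ) (q : Vertex) :
    ℕ → ℝ := absorb (x q) (nbrs q \ T) (f q)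

/-- With the ratios `a`, `b` of the two branches at `l` other than the one towards `p`, the absorbed
weights are `W 1 = (1 + a)(1 + b)`, `W 2 = 1 + a + b` and `W 3 = 1`, so their quotient is the one in
the recursion. The lower bound keeps the factor pulled out at `l` positive. -/
theorem effWeight_one_eq_branchRatio_mul {T' : Set Vertex} {p l : Vertex} {T : Finset Vertex}
    (hN : nbrs l ∩ T = {p}) (hlT : l ∉ T) (hl : l ∈ T') {f : Vertex → ℕ → ℝ} (hf : f l = unitWeight) :
    let W := effWeight (branchRatio T') (insert l T) f l
    1 ≤ W 2 + W 3 ∧ W 1 = branchRatio T' p l * (W 2 + W 3) := by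
  intro W
  have hp : p ∈ nbrs l ∩ T := by simp [hN]
  rw [Finset.mem_inter] at hp
  have hsd : nbrs l \ insert l T = (nbrs l).erase p := by
    ext x
    have hx : x ∈ nbrs l → x ≠ l := by
      rintro h rfl
      exact notMem_nbrs_self _ h
    have hx' : x ∈ nbrs l ∩ T ↔ x = p := by rw [hN, Finset.mem_singleton]
    rw [Finset.mem_inter] at hx'
    simp only [Finset.mem_sdiff, Finset.mem_insert, Finset.mem_erase]
    tauto
  have hcard : ((nbrs l).erase p).card = 2 := by
    rw [Finset.card_erase_of_mem hp.1, card_nbrs]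
  obtain ⟨a, b, hab, hE⟩ := Finset.card_eq_two.1 hcard
  have hW : ∀ k, W k = absorb (branchRatio T' l) {a, b} unitWeight k := by
    intro k
    simp only [W, effWeight, hsd, hE, hf]
  have hab' : a ∉ ({b} : Finset Vertex) := by simpa using hab
  have hb' : b ∉ (∅ : Finset Vertex) := by simp
  have hr := branchRatio_eq hl hab hE
  have ha0 := branchRatio_nonneg T' l a
  have hb0 := branchRatio_nonneg T' l b
  have hW' : ∀ k, W k = unitWeight k + branchRatio T' l b * unitWeight (k + 1) +
      branchRatio T' l a * (unitWeight (k + 1) + branchRatio T' l b * unitWeight (k + 2)) := by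
    intro k
    rw [hW, absorb_insert _ hab', ← insert_empty_eq b]
    simp only [absorb_insert _ hb', absorb_empty]
  have h1 : W 1 = (1 + branchRatio T' l a) * (1 + branchRatio T' l b) := by
    rw [hW']
    norm_num [unitWeight]
    ring
  have h2 : W 2 + W 3 = 2 + branchRatio T' l a + branchRatio T' l b := by
    rw [hW', hW']
    norm_num [unitWeight]
    ring
  rw [h1, h2]
  exact ⟨by linarith, hr.symm⟩

/-- Summing out the vertices of a finite subtree outside a smaller one. -/
theorem exists_pf_eq_mul_pf {T' : Finset Vertex} (hT' : IsSubtree (T' : Set Vertex)) :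
    ∀ (n : ℕ) (T : Finset Vertex), IsSubtree (T : Set Vertex) → T ⊆ T' → (T' \ T).card = n →
    ∃ c : ℝ, 0 < c ∧ ∀ f : Vertex → ℕ → ℝ, (∀ q k, 4 ≤ k → f q k = 0) →
      (∀ q ∉ T, f q = unitWeight) →
      pf T' f = c * pf T (effWeight (branchRatio T') T f) := by
  intro n
  induction n with
  | zero =>
    intro T hT hsub hn
    have hTT : T = T' := by
      refine hsub.antisymm ?_
      rwa [Finset.card_eq_zero, Finset.sdiff_eq_empty_iff_subset] at hn
    subst hTT
    refine ⟨1, one_pos, fun f _ _ => ?_⟩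
    rw [one_mul]
    refine pf_congr fun q hq => ?_
    rw [effWeight, absorb_of_eq_zero]
    intro a ha
    exact branchRatio_of_notMem _ (by simpa using (Finset.mem_sdiff.1 ha).2)
  | succ n ih =>
    intro T hT hsub hn
    have hne : T ≠ T' := by
      rintro rfl
      simp at hn
    obtain ⟨l, hlT', hlT, p, hpT, hlp⟩ := exists_adj_of_ssubset hT.nonempty hT'
      (Finset.coe_ssubset.2 (hsub.ssubset_of_ne hne))
    rw [Finset.mem_coe] at hlT' hlT hpT
    have hN : nbrs l ∩ T = {p} := by
      ext x
      rw [Finset.mem_inter, Finset.mem_singleton]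
      constructor
      · rintro ⟨h1, h2⟩
        exact hT.eq_of_adj (l := l) (by simpa using hlT) h2 hpT (mem_nbrs.1 h1) hlp
      · rintro rfl
        exact ⟨mem_nbrs.2 hlp, hpT⟩
    -- Everything beyond `insert l T` is already summed out; only `l`, a leaf of that tree, remains.
    obtain ⟨c, hc, hcf⟩ := ih (insert l T)
      (by rw [Finset.coe_insert]; exact hT.insert_of_adj (Finset.mem_coe.2 hpT) hlp)
      (Finset.insert_subset hlT' hsub)
      (by
        have : T' \ insert l T = (T' \ T).erase l := by
          ext x
          simp only [Finset.mem_sdiff, Finset.mem_insert, Finset.mem_erase]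
          tauto
        rw [this, Finset.card_erase_of_mem (Finset.mem_sdiff.2 ⟨hlT', hlT⟩), hn]
        rfl)
    -- the factor contributed by `l` does not depend on `f`
    let s := effWeight (branchRatio T') (insert l T) (fun _ => unitWeight) l 2 +
      effWeight (branchRatio T') (insert l T) (fun _ => unitWeight) l 3
    have hs : 1 ≤ s := (effWeight_one_eq_branchRatio_mul (f := fun _ => unitWeight) hN hlT hlT' rfl).1
    refine ⟨c * s, mul_pos hc (by linarith), fun f hf4 hf1 => ?_⟩
    have hfl : effWeight (branchRatio T') (insert l T) f l =
        effWeight (branchRatio T') (insert l T) (fun _ => unitWeight) l := by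
      rw [effWeight, effWeight, hf1 l hlT]
    obtain ⟨-, hw⟩ := effWeight_one_eq_branchRatio_mul (T' := (T' : Set Vertex)) hN hlT hlT' (hf1 l hlT)
    have hlp' : l ∉ nbrs p \ insert l T := by simp
    -- Once `l` is removed, it becomes one more branch hanging at `p`.
    have hsd : nbrs p \ T = insert l (nbrs p \ insert l T) := by
      ext x
      have : l ∈ nbrs p := mem_nbrs.2 hlp.symm
      simp only [Finset.mem_sdiff, Finset.mem_insert]
      by_cases hx : x = l
      · subst hx
        tauto
      · tauto
    rw [hcf f hf4 fun q hq => hf1 q fun h => hq (Finset.mem_insert_of_mem h),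
      pf_insert hlT hN _ (absorb_zero_of_le (hf4 p) le_rfl), mul_assoc]
    congr 1
    -- The factor `s` is moved into the weight at `p`, so that the two sides can be compared site by
    -- site.
    rw [← Function.update_eq_self p (effWeight (branchRatio T') T f),
      ← pf_update_const_mul hpT]
    refine pf_congr fun q hq => ?_
    by_cases hqp : q = p
    · subst hqp
      rw [Function.update_self, Function.update_self]
      ext k
      have hins : effWeight (branchRatio T') T f q k = effWeight (branchRatio T') (insert l T) f q k +
          branchRatio T' q l * effWeight (branchRatio T') (insert l T) f q (k + 1) := by
        rw [effWeight, hsd, absorb_insert _ hlp']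
        rfl
      rw [hw, hfl, hins]
      ring
    · rw [Function.update_of_ne hqp, Function.update_of_ne hqp, effWeight, effWeight]
      have : nbrs q \ insert l T = nbrs q \ T := by
        ext x
        simp only [Finset.mem_sdiff, Finset.mem_insert]
        have : x ∈ nbrs q → x ≠ l := by
          rintro h rfl
          have : q ∈ nbrs x ∩ T := Finset.mem_inter.2 ⟨mem_nbrs_comm.1 h, hq⟩
          rw [hN, Finset.mem_singleton] at this
          exact hqp this
        tauto
      rw [this]

/-- Reducing the unweighted count to a single vertex shows that a recurrent configuration exists;
its term is positive for `W`. -/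
theorem pf_pos {T : Finset Vertex} (hT : IsSubtree (T : Set Vertex)) {W : Vertex → ℕ → ℝ}
    (hW : ∀ q ∈ T, ∀ k, 0 ≤ W q k) (hW' : ∀ q ∈ T, ∀ k ∈ Finset.Icc 1 3, 0 < W q k) :
    0 < pf T W := by
  obtain ⟨v, hv⟩ := hT.nonempty
  obtain ⟨c, hc, h⟩ := exists_pf_eq_mul_pf hT _ {v}
    (by rw [Finset.coe_singleton]; exact isSubtree_singleton v) (by simpa using hv) rfl
  have h1 := h (fun _ => unitWeight) (fun _ _ => unitWeight_zero_of_le) (fun _ _ => rfl)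
  have hle : ∀ k, unitWeight k ≤ effWeight (branchRatio T) {v} (fun _ => unitWeight) v k :=
    fun k => le_absorb (branchRatio_nonneg _ v) unitWeight_nonneg k
  have hpos : 0 < pf T fun _ => unitWeight := by
    rw [h1, pf_singleton]
    have h1 := hle 1
    have h2 := hle 2
    have h3 := hle 3
    norm_num [unitWeight] at h1 h2 h3
    refine mul_pos hc ?_
    linarith
  obtain ⟨c, hc, hc'⟩ : ∃ c ∈ confs T, IsRec T c := by
    by_contra! hno
    refine hpos.ne' (Finset.sum_eq_zero fun c hc => if_neg (hno c hc))
  refine Finset.sum_pos' (fun c _ => ?_) ⟨c, hc, ?_⟩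
  · split_ifs
    · exact Finset.prod_nonneg fun q hq => hW q hq _
    · exact le_rfl
  · rw [if_pos hc']
    exact Finset.prod_pos fun q hq => hW' q hq _ ((mem_confs.1 hc).2 q hq)

/-! ### Decay of covariances along a path -/

theorem isSubtree_support {u v : Vertex} (p : bethe.Walk u v) :
    IsSubtree (p.support.toFinset : Set Vertex) := by
  rw [List.coe_toFinset]
  exact p.connected_induce_support

/-- The partition function on a path as a function of the weights at its two ends. -/
def pathPf {u v : Vertex} (p : bethe.Walk u v) (W : Vertex → ℕ → ℝ) (f g : ℕ → ℝ) : ℝ :=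
  pf p.support.toFinset (Function.update (Function.update W v g) u f)

theorem pathPf_cons_nil {u v : Vertex} (h : bethe.Adj u v) (W : Vertex → ℕ → ℝ) (f g : ℕ → ℝ)
    (hg : g 4 = 0) :
    pathPf (.cons h .nil) W f g =
      (f 2 + f 3) * (g 1 + g 2 + g 3) + f 1 * (g 2 + g 3) := by
  have hne := h.ne
  have hN : nbrs u ∩ {v} = {v} := by simpa using mem_nbrs.2 h
  have hs : (SimpleGraph.Walk.cons h SimpleGraph.Walk.nil).support.toFinset = insert u {v} := by
    simp
  rw [pathPf, hs, pf_insert (by simpa using hne) hN, pf_singleton]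
  · simp only [Function.update_self, Function.update_of_ne hne.symm, Nat.reduceAdd, hg]
    ring
  · rw [Function.update_of_ne hne.symm, Function.update_self, hg]

theorem pathPf_cons {u w v : Vertex} (h : bethe.Adj u w) (p : bethe.Walk w v) (hu : u ∉ p.support)
    (hwv : w ≠ v) (W : Vertex → ℕ → ℝ) (hW : W w 4 = 0) (f g : ℕ → ℝ) :
    pathPf (.cons h p) W f g =
      pathPf p W (fun k => (f 2 + f 3) * W w k + f 1 * W w (k + 1)) g := by
  have hne := h.ne
  have hN : nbrs u ∩ p.support.toFinset = {w} := by
    ext x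
    rw [Finset.mem_inter, Finset.mem_singleton]
    constructor
    · rintro ⟨h1, h2⟩
      exact (isSubtree_support p).eq_of_adj (l := u) (by simpa using hu) h2 (by simp)
        (mem_nbrs.1 h1) h
    · rintro rfl
      exact ⟨mem_nbrs.2 h, by simp⟩
  have hs : (SimpleGraph.Walk.cons h p).support.toFinset = insert u p.support.toFinset := by
    simp
  rw [pathPf, hs, pf_insert (by simpa using hu) hN, pathPf]
  · refine pf_congr fun q hq => ?_
    by_cases hqw : q = w
    · subst hqw
      simp only [Function.update_self, Function.update_of_ne hne.symm, Function.update_of_ne hwv]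
    · have hqu : q ≠ u := by
        rintro rfl
        exact hu (by simpa using hq)
      simp only [Function.update_of_ne hqw, Function.update_of_ne hqu]
  · rw [Function.update_of_ne hne.symm, Function.update_of_ne hwv, hW]

/-- The end weight `f` matters only through the pair `(f 2 + f 3, f 1)`. Moving on to the next
vertex `w` multiplies the determinant of two such pairs by `W w 2 ^ 2`, and `f 2 + f 3 + f 1 / 2` at
least by `2 * W w 2`. That functional is the left eigenvector in the extreme case `W w 2 = 2 * W w
3`. -/
theorem pathPf_det_le {v : Vertex} {W : Vertex → ℕ → ℝ} (hW : ∀ q, W q 4 = 0) {g G : ℕ → ℝ}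
    (hg4 : g 4 = 0) (hG4 : G 4 = 0) (hG : ∀ k, 0 ≤ G k) (hGg : ∀ k, G k ≤ g k)
    (hg : g 1 ≤ g 2 + g 3) : ∀ {u : Vertex} (p : bethe.Walk u v), p.IsPath → u ≠ v →
    (∀ q ∈ p.support, q ≠ u → q ≠ v → W q 1 = W q 2 ∧ W q 2 ≤ 2 * W q 3 ∧ 0 < W q 2) →
    ∀ f F : ℕ → ℝ, 0 ≤ f 1 → 0 ≤ f 2 → 0 ≤ f 3 →
    |pathPf p W F G * pathPf p W f g - pathPf p W F g * pathPf p W f G| *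
        (4 ^ p.length * (f 2 + f 3 + f 1 / 2) ^ 2) ≤
      4 * |(F 2 + F 3) * f 1 - F 1 * (f 2 + f 3)| * pathPf p W f g ^ 2 := by
  intro u p
  induction p with
  | nil => exact fun _ h => absurd rfl h
  | @cons u w v h p ih =>
    intro hp huv hint f F hf1 hf2 hf3
    rw [SimpleGraph.Walk.cons_isPath_iff] at hp
    by_cases hwv : w = v
    · subst hwv
      have hnil : p = .nil := by simpa using hp.1
      subst hnil
      simp only [pathPf_cons_nil h W _ _ hg4, pathPf_cons_nil h W _ _ hG4]
      -- On a single edge the determinant splits into one factor for each end.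
      have e : ((F 2 + F 3) * (G 1 + G 2 + G 3) + F 1 * (G 2 + G 3)) *
            ((f 2 + f 3) * (g 1 + g 2 + g 3) + f 1 * (g 2 + g 3)) -
          ((F 2 + F 3) * (g 1 + g 2 + g 3) + F 1 * (g 2 + g 3)) *
            ((f 2 + f 3) * (G 1 + G 2 + G 3) + f 1 * (G 2 + G 3)) =
          ((F 2 + F 3) * f 1 - F 1 * (f 2 + f 3)) *
            ((G 1 + G 2 + G 3) * (g 2 + g 3) - (g 1 + g 2 + g 3) * (G 2 + G 3)) := by ring
      have hG1 := hG 1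
      have hG2 := hG 2
      have hG3 := hG 3
      have hg1 := hGg 1
      have hg2 := hGg 2
      have hg3 := hGg 3
      have hσ : |(G 1 + G 2 + G 3) * (g 2 + g 3) - (g 1 + g 2 + g 3) * (G 2 + G 3)| ≤
          (g 1 + g 2 + g 3) ^ 2 := by
        have a1 : (G 1 + G 2 + G 3) * (g 2 + g 3) ≤ (g 1 + g 2 + g 3) * (g 1 + g 2 + g 3) :=
          mul_le_mul (by linarith) (by linarith) (by linarith) (by linarith)
        have a2 : (g 1 + g 2 + g 3) * (G 2 + G 3) ≤ (g 1 + g 2 + g 3) * (g 1 + g 2 + g 3) :=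
          mul_le_mul_of_nonneg_left (by linarith) (by linarith)
        have a3 : 0 ≤ (G 1 + G 2 + G 3) * (g 2 + g 3) := mul_nonneg (by linarith) (by linarith)
        have a4 : 0 ≤ (g 1 + g 2 + g 3) * (G 2 + G 3) := mul_nonneg (by linarith) (by linarith)
        rw [abs_le]
        constructor <;> nlinarith
      -- Here `g 1 ≤ g 2 + g 3` says that `g 2 + g 3` is at least half of the total. The constant 4
      -- on the right of the claim offsets `4 ^ 1` for this one edge.
      have hB : (g 1 + g 2 + g 3) * (f 2 + f 3 + f 1 / 2) ≤
          (f 2 + f 3) * (g 1 + g 2 + g 3) + f 1 * (g 2 + g 3) := by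
        nlinarith [mul_nonneg hf1 (sub_nonneg.2 hg)]
      have hB0 : 0 ≤ (g 1 + g 2 + g 3) * (f 2 + f 3 + f 1 / 2) :=
        mul_nonneg (by linarith) (by linarith [hf1, hf2, hf3])
      have hB2 := pow_le_pow_left₀ hB0 hB 2
      rw [e, abs_mul]
      set δ := |(F 2 + F 3) * f 1 - F 1 * (f 2 + f 3)|
      have hδ : 0 ≤ δ := abs_nonneg _
      simp only [SimpleGraph.Walk.length_cons, SimpleGraph.Walk.length_nil, zero_add, pow_one]
      calc _ ≤ δ * (g 1 + g 2 + g 3) ^ 2 * (4 * (f 2 + f 3 + f 1 / 2) ^ 2) := by gcongr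
        _ = 4 * δ * ((g 1 + g 2 + g 3) * (f 2 + f 3 + f 1 / 2)) ^ 2 := by ring
        _ ≤ _ := by gcongr
    · have hwu : w ≠ u := h.ne.symm
      obtain ⟨hW1, hW2, hW0⟩ := hint w (by simp) hwu hwv
      simp only [pathPf_cons h p hp.2 hwv W (hW w)]
      have hW3 : 0 ≤ W w 3 := by linarith
      have hW4 := hW w
      set s := f 2 + f 3 with hs
      have hs0 : 0 ≤ s := add_nonneg hf2 hf3
      have hint' : ∀ q ∈ p.support, q ≠ w → q ≠ v → W q 1 = W q 2 ∧ W q 2 ≤ 2 * W q 3 ∧ 0 < W q 2 := by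
        intro q hq _ hqv
        refine hint q (by simp [hq]) ?_ hqv
        rintro rfl
        exact hp.2 hq
      have hIH := ih hp.1 hwv hint' (fun k => s * W w k + f 1 * W w (k + 1))
        (fun k => (F 2 + F 3) * W w k + F 1 * W w (k + 1))
        (by rw [hW1]; positivity) (by positivity)
        (by rw [hW4]; positivity)
      simp only [Nat.reduceAdd, hW4, hW1, mul_zero, add_zero] at hIH
      set B := pathPf p W (fun k => s * W w k + f 1 * W w (k + 1)) g
      set D := |pathPf p W (fun k => (F 2 + F 3) * W w k + F 1 * W w (k + 1)) G * B -
        pathPf p W (fun k => (F 2 + F 3) * W w k + F 1 * W w (k + 1)) g *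
          pathPf p W (fun k => s * W w k + f 1 * W w (k + 1)) G|
      have hδ : ((F 2 + F 3) * W w 2 + F 1 * W w 3 + (F 2 + F 3) * W w 3) *
            (s * W w 2 + f 1 * W w 2) -
          ((F 2 + F 3) * W w 2 + F 1 * W w 2) * (s * W w 2 + f 1 * W w 3 + s * W w 3) =
          W w 2 ^ 2 * ((F 2 + F 3) * f 1 - F 1 * s) := by ring
      rw [hδ, abs_mul, abs_of_pos (pow_pos hW0 2)] at hIH
      -- The slack is `(s + f 1) * (W w 3 - W w 2 / 2)`.
      have hlam : 2 * W w 2 * (s + f 1 / 2) ≤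
          s * W w 2 + f 1 * W w 3 + s * W w 3 + (s * W w 2 + f 1 * W w 2) / 2 := by
        nlinarith [mul_nonneg hs0 (sub_nonneg.2 hW2), mul_nonneg hf1 (sub_nonneg.2 hW2)]
      have hlam2 := pow_le_pow_left₀ (by positivity) hlam 2
      refine le_of_mul_le_mul_right (a := W w 2 ^ 2) ?_ (pow_pos hW0 2)
      calc D * (4 ^ (p.length + 1) * (s + f 1 / 2) ^ 2) * W w 2 ^ 2
          = D * (4 ^ p.length * (2 * W w 2 * (s + f 1 / 2)) ^ 2) := by ring
        _ ≤ D * (4 ^ p.length *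
            (s * W w 2 + f 1 * W w 3 + s * W w 3 + (s * W w 2 + f 1 * W w 2) / 2) ^ 2) := by
          have : 0 ≤ D := abs_nonneg _
          gcongr
        _ ≤ _ := hIH
        _ = _ := by ring

theorem two_le_card_nbrs_inter_support {u v q : Vertex} (p : bethe.Walk u v) (hp : p.IsPath)
    (hq : q ∈ p.support) (hu : q ≠ u) (hv : q ≠ v) :
    2 ≤ (nbrs q ∩ p.support.toFinset).card := by
  obtain ⟨i, rfl, hi⟩ := SimpleGraph.Walk.mem_support_iff_exists_getVert.1 hq
  have h0 : i ≠ 0 := by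
    rintro rfl
    exact hu p.getVert_zero
  have hl : i < p.length := by
    refine lt_of_le_of_ne hi ?_
    rintro rfl
    exact hv p.getVert_length
  obtain ⟨j, rfl⟩ := Nat.exists_eq_succ_of_ne_zero h0
  have hne : p.getVert j ≠ p.getVert (j + 1 + 1) := by
    intro h
    have := hp.getVert_injOn (by rw [Set.mem_ofPred]; omega) (by rw [Set.mem_ofPred]; omega) h
    omega
  have h1 := p.adj_getVert_succ (i := j) (by omega)
  have h2 := p.adj_getVert_succ (i := j + 1) hl
  rw [← Finset.card_pair hne]
  refine Finset.card_le_card ?_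
  intro x hx
  rw [Finset.mem_insert, Finset.mem_singleton] at hx
  rw [Finset.mem_inter, mem_nbrs, List.mem_toFinset]
  rcases hx with rfl | rfl
  · exact ⟨h1.symm, p.getVert_mem_support _⟩
  · exact ⟨h2, p.getVert_mem_support _⟩

theorem one_le_card_nbrs_inter_support {u v : Vertex} (p : bethe.Walk u v) (huv : u ≠ v) :
    1 ≤ (nbrs v ∩ p.support.toFinset).card := by
  obtain ⟨l, hl, hlv, x, hx, hlx⟩ := exists_adj_of_ssubset (T := {v}) (by simp)
    (isSubtree_support p) ⟨by simp, fun h => huv (h (by simp : u ∈ _))⟩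
  rw [Set.mem_singleton_iff] at hx
  subst hx
  exact Finset.card_pos.2 ⟨l, Finset.mem_inter.2 ⟨mem_nbrs.2 hlx.symm, hl⟩⟩

theorem card_nbrs_sdiff (q : Vertex) (S : Finset Vertex) :
    (nbrs q \ S).card + (nbrs q ∩ S).card = 3 := by
  rw [Finset.card_sdiff_add_card_inter, card_nbrs]

/-- The weights are `1 + x, 1 + x, 1`, with `x = 0` when there is no branch. This is the situation
inside a path. -/
theorem absorb_unitWeight_of_card_le_one {x : Vertex → ℝ} (hx0 : ∀ a, 0 ≤ x a) (hx1 : ∀ a, x a ≤ 1)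
    {N : Finset Vertex} (hN : N.card ≤ 1) :
    absorb x N unitWeight 1 = absorb x N unitWeight 2 ∧
      absorb x N unitWeight 2 ≤ 2 * absorb x N unitWeight 3 ∧ 0 < absorb x N unitWeight 2 := by
  rcases Finset.card_le_one_iff_subset_singleton.1 hN with ⟨a, ha⟩
  rcases Finset.subset_singleton_iff.1 ha with rfl | rfl
  · rw [absorb_empty]
    norm_num [unitWeight]
  · have h := absorb_insert x (Finset.notMem_empty a) unitWeight
    rw [insert_empty_eq, absorb_empty] at h
    rw [h, h, h]
    have := hx0 a
    have := hx1 a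
    norm_num [unitWeight]
    constructor <;> linarith

/-- For two branches the claim is `(1 + a)(1 + b) ≤ 2 + a + b`, that is `a * b ≤ 1`. This is the
situation at the end of a path. -/
theorem absorb_unitWeight_of_card_le_two {x : Vertex → ℝ} (hx0 : ∀ a, 0 ≤ x a) (hx1 : ∀ a, x a ≤ 1)
    {N : Finset Vertex} (hN : N.card ≤ 2) :
    absorb x N unitWeight 1 ≤ absorb x N unitWeight 2 + absorb x N unitWeight 3 := by
  rcases hN.lt_or_eq with h | h
  · obtain ⟨h1, h2, h3⟩ := absorb_unitWeight_of_card_le_one hx0 hx1 (Nat.lt_succ_iff.1 h)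
    linarith
  · obtain ⟨a, b, hab, rfl⟩ := Finset.card_eq_two.1 h
    have hb := absorb_insert x (Finset.notMem_empty b) unitWeight
    rw [insert_empty_eq, absorb_empty] at hb
    have ha := absorb_insert x (N := {b}) (a := a) (by simpa using hab) unitWeight
    rw [ha, ha, ha, hb, hb, hb, hb]
    norm_num [unitWeight]
    nlinarith [hx0 a, hx0 b, hx1 a, hx1 b]

/-- The weights `unitWeight` changed to `φ` at `u` and to `ψ` at `v`. -/
def twoSite (u v : Vertex) (φ ψ : ℕ → ℝ) : Vertex → ℕ → ℝ :=
  Function.update (Function.update (fun _ => unitWeight) v ψ) u φ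

theorem abs_pf_twoSite_le {x : Vertex → Vertex → ℝ} (hx0 : ∀ p q, 0 ≤ x p q)
    (hx1 : ∀ p q, x p q ≤ 1) {u v : Vertex} (p : bethe.Walk u v) (hp : p.IsPath) (huv : u ≠ v)
    {φ ψ : ℕ → ℝ} (hφ0 : ∀ k, 0 ≤ φ k) (hφ1 : ∀ k, φ k ≤ unitWeight k)
    (hψ0 : ∀ k, 0 ≤ ψ k) (hψ1 : ∀ k, ψ k ≤ unitWeight k) :
    let Z := fun φ ψ => pf p.support.toFinset (effWeight x p.support.toFinset (twoSite u v φ ψ))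
    |Z φ ψ * Z unitWeight unitWeight - Z φ unitWeight * Z unitWeight ψ| ≤
      2 * (1 / 4) ^ p.length * Z unitWeight unitWeight ^ 2 := by
  intro Z
  set S := p.support.toFinset
  let W := effWeight x S fun _ => unitWeight
  let F : (ℕ → ℝ) → ℕ → ℝ := absorb (x u) (nbrs u \ S)
  let G : (ℕ → ℝ) → ℕ → ℝ := absorb (x v) (nbrs v \ S)
  have hZ : ∀ φ ψ, Z φ ψ = pathPf p W (F φ) (G ψ) := by
    intro φ ψ
    refine pf_congr fun q _ => ?_
    rw [effWeight, twoSite]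
    by_cases hqu : q = u
    · subst hqu
      rw [Function.update_self, Function.update_self]
    · rw [Function.update_of_ne hqu, Function.update_of_ne hqu]
      by_cases hqv : q = v
      · subst hqv
        rw [Function.update_self, Function.update_self]
      · rw [Function.update_of_ne hqv, Function.update_of_ne hqv]
        rfl
  have h4 : ∀ {χ : ℕ → ℝ}, (∀ k, 0 ≤ χ k) → (∀ k, χ k ≤ unitWeight k) → ∀ k, 4 ≤ k → χ k = 0 :=
    fun h0 h1 k hk => le_antisymm ((h1 k).trans (unitWeight_zero_of_le hk).le) (h0 k)
  have hmain := pathPf_det_le (W := W) (g := G unitWeight) (G := G ψ)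
    (fun q => absorb_zero_of_le (fun _ => unitWeight_zero_of_le) le_rfl)
    (absorb_zero_of_le (fun _ => unitWeight_zero_of_le) le_rfl)
    (absorb_zero_of_le (h4 hψ0 hψ1) le_rfl)
    (absorb_nonneg (hx0 v) hψ0) (absorb_mono (hx0 v) hψ1)
    (absorb_unitWeight_of_card_le_two (hx0 v) (hx1 v) (by
      have : 1 ≤ (nbrs v ∩ S).card := one_le_card_nbrs_inter_support p huv
      have := card_nbrs_sdiff v S
      omega)) p hp huv
    (fun q hq hqu hqv => absorb_unitWeight_of_card_le_one (hx0 q) (hx1 q) (by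
      have : 2 ≤ (nbrs q ∩ S).card := two_le_card_nbrs_inter_support p hp hq hqu hqv
      have := card_nbrs_sdiff q S
      omega)) (F unitWeight) (F φ)
    (absorb_nonneg (hx0 u) unitWeight_nonneg 1) (absorb_nonneg (hx0 u) unitWeight_nonneg 2)
    (absorb_nonneg (hx0 u) unitWeight_nonneg 3)
  rw [← hZ, ← hZ, ← hZ, ← hZ] at hmain
  have hf1 : 0 ≤ F unitWeight 1 := absorb_nonneg (hx0 u) unitWeight_nonneg 1
  have hf2 : 1 ≤ F unitWeight 2 := by
    have := le_absorb (N := nbrs u \ S) (hx0 u) unitWeight_nonneg 2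
    rwa [show unitWeight 2 = 1 by norm_num [unitWeight]] at this
  have hf3 : 0 ≤ F unitWeight 3 := absorb_nonneg (hx0 u) unitWeight_nonneg 3
  have hF0 : ∀ k, 0 ≤ F φ k := absorb_nonneg (hx0 u) hφ0
  have hF1 : ∀ k, F φ k ≤ F unitWeight k := absorb_mono (hx0 u) hφ1
  set s := F unitWeight 2 + F unitWeight 3 with hs
  set w := F unitWeight 1
  -- Both products lie between 0 and `s * w`, and `2 * s * w ≤ (s + w / 2) ^ 2`.
  have hδ : 4 * |(F φ 2 + F φ 3) * w - F φ 1 * s| ≤ 2 * (s + w / 2) ^ 2 := by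
    have a1 : 0 ≤ (F φ 2 + F φ 3) * w := mul_nonneg (add_nonneg (hF0 2) (hF0 3)) hf1
    have a2 : (F φ 2 + F φ 3) * w ≤ s * w :=
      mul_le_mul_of_nonneg_right (add_le_add (hF1 2) (hF1 3)) hf1
    have a3 : 0 ≤ F φ 1 * s := mul_nonneg (hF0 1) (by linarith)
    have a4 : F φ 1 * s ≤ w * s := mul_le_mul_of_nonneg_right (hF1 1) (by linarith)
    have a5 : |(F φ 2 + F φ 3) * w - F φ 1 * s| ≤ s * w := by
      rw [abs_le]
      constructor <;> linarith
    nlinarith [sq_nonneg (s - w / 2)]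
  have hpos : 0 < 4 ^ p.length * (s + w / 2) ^ 2 := by
    have : 0 < s + w / 2 := by linarith
    positivity
  refine le_of_mul_le_mul_right (hmain.trans ?_) hpos
  calc _ ≤ 2 * (s + w / 2) ^ 2 * Z unitWeight unitWeight ^ 2 := by gcongr
    _ = 2 * (1 / 4 * 4) ^ p.length * Z unitWeight unitWeight ^ 2 * (s + w / 2) ^ 2 := by
      norm_num
      ring
    _ = _ := by
      rw [mul_pow]
      ring

/-! ### Cylinder probabilities in finite subtrees -/

/-- A configuration on `T` as a height function on all vertices, with height `d` outside `T`. -/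
def extendConfig {T : Set Vertex} (d : ℕ) (η : Config T) (q : Vertex) : ℕ :=
  open Classical in if h : q ∈ T then (η ⟨q, h⟩ : ℕ) else d

theorem extendConfig_of_mem {T : Set Vertex} (d : ℕ) (η : Config T) {q : Vertex} (h : q ∈ T) :
    extendConfig d η q = η ⟨q, h⟩ := dif_pos h

theorem extendConfig_of_notMem {T : Set Vertex} (d : ℕ) (η : Config T) {q : Vertex} (h : q ∉ T) :
    extendConfig d η q = d := dif_neg h

theorem ncard_adj_eq {T : Set Vertex} (S : Finset T) (u : T) :
    {w : T | w ∈ S ∧ (bethe.induce T).Adj u w}.ncard =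
      (nbrs u ∩ S.map (Function.Embedding.subtype _)).card := by
  rw [← Set.ncard_coe_finset, ← Set.ncard_image_of_injective _ Subtype.val_injective]
  congr 1
  ext x
  simp only [Set.mem_image, Set.mem_ofPred_eq, Finset.coe_inter, Finset.coe_map, Set.mem_inter_iff,
    Finset.mem_coe, Function.Embedding.subtype_apply, mem_nbrs, SimpleGraph.comap_adj]
  constructor
  · rintro ⟨w, ⟨hw, hadj⟩, rfl⟩
    exact ⟨hadj, w, hw, rfl⟩
  · rintro ⟨hadj, w, hw, rfl⟩
    exact ⟨w, ⟨hw, hadj⟩, rfl⟩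

theorem mem_recurrent_iff {T : Finset Vertex} (d : ℕ) (η : Config (T : Set Vertex)) :
    η ∈ recurrent (T : Set Vertex) ↔ IsRec T (extendConfig d η) := by
  simp only [recurrent, Set.mem_ofPred_eq, IsForbidden, not_and, not_forall, not_le, exists_prop]
  constructor
  · intro h S hS hne
    classical
    obtain ⟨u, hu, hlt⟩ := h (S.subtype (· ∈ (T : Set Vertex))) (by
      obtain ⟨x, hx⟩ := hne
      exact ⟨⟨x, hS hx⟩, by simpa using hx⟩)
    refine ⟨u, by simpa using hu, ?_⟩
    rw [ncard_adj_eq, Finset.subtype_map_of_mem fun x hx => by simpa using hS hx] at hlt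
    rwa [extendConfig_of_mem d η u.2]
  · intro h S hne
    obtain ⟨u, hu, hlt⟩ := h (S.map (Function.Embedding.subtype _)) (by
      intro x hx
      obtain ⟨y, -, rfl⟩ := Finset.mem_map.1 hx
      exact y.2) (hne.map)
    obtain ⟨y, hy, rfl⟩ := Finset.mem_map.1 hu
    refine ⟨y, hy, ?_⟩
    rw [ncard_adj_eq]
    rwa [Function.Embedding.subtype_apply, extendConfig_of_mem d η y.2] at hlt

theorem sum_confs_eq_sum_config (T : Finset Vertex) (F : (Vertex → ℕ) → ℝ) :
    ∑ h ∈ confs T, F h = ∑ η : Config (T : Set Vertex), F (extendConfig 0 η) := by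
  refine Finset.sum_bij'
    (fun h hh => fun q => ⟨h q, (mem_confs.1 hh).2 q q.2⟩)
    (fun η _ => Finsupp.onFinset T (extendConfig 0 η) fun q hq => by
      by_contra h
      exact hq (extendConfig_of_notMem 0 η (by simpa using h))) ?_ ?_ ?_ ?_ ?_
  · intro h hh
    exact Finset.mem_univ _
  · intro η _
    rw [mem_confs]
    refine ⟨Finsupp.support_onFinset_subset, fun q hq => ?_⟩
    rw [Finsupp.onFinset_apply, extendConfig_of_mem 0 η (by simpa using hq)]
    exact Subtype.coe_prop _
  · intro h hh
    ext q
    rw [Finsupp.onFinset_apply]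
    by_cases hq : q ∈ (T : Set Vertex)
    · rw [extendConfig_of_mem _ _ hq]
    · rw [extendConfig_of_notMem _ _ hq]
      by_contra hne
      exact hq ((mem_confs.1 hh).1 (Finsupp.mem_support_iff.2 (Ne.symm hne)))
  · intro η _
    ext q
    simp only [Finsupp.onFinset_apply]
    rw [extendConfig_of_mem 0 η q.2]
  · intro h hh
    congr 1
    ext q
    by_cases hq : q ∈ (T : Set Vertex)
    · rw [extendConfig_of_mem _ _ hq]
    · rw [extendConfig_of_notMem _ _ hq]
      by_contra hne
      exact hq ((mem_confs.1 hh).1 (Finsupp.mem_support_iff.2 hne))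

open Classical in
/-- The single-site weights singling out the configurations that agree with `ξ` on `W`. -/
def cylinderWeight {T : Set Vertex} (W : Finset T) (ξ : Config T) (q : Vertex) (k : ℕ) : ℝ :=
  if q ∈ W.map (Function.Embedding.subtype _) then (if k = extendConfig 0 ξ q then 1 else 0)
    else unitWeight k

theorem cylinderWeight_of_mem {T : Set Vertex} {W : Finset T} (ξ : Config T) {w : T} (hw : w ∈ W)
    (k : ℕ) : cylinderWeight W ξ w k = if k = ξ w then 1 else 0 := by
  classical
  have hw' : (w : Vertex) ∈ W.map (Function.Embedding.subtype _) := Finset.mem_map_of_mem _ hw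
  rw [cylinderWeight, if_pos hw', extendConfig_of_mem 0 ξ w.2]

theorem cylinderWeight_of_notMem {T : Set Vertex} {W : Finset T} (ξ : Config T) {q : Vertex}
    (hq : q ∉ W.map (Function.Embedding.subtype _)) : cylinderWeight W ξ q = unitWeight := by
  ext k
  rw [cylinderWeight, if_neg hq]

theorem cylinderWeight_nonneg {T : Set Vertex} (W : Finset T) (ξ : Config T) (q : Vertex) (k : ℕ) :
    0 ≤ cylinderWeight W ξ q k := by
  unfold cylinderWeight
  split_ifs
  · exact zero_le_one
  · exact le_rfl
  · exact unitWeight_nonneg k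

theorem height_le (a : Height) : (a : ℕ) ≤ 3 := (Finset.mem_Icc.1 a.2).2

theorem cylinderWeight_le {T : Set Vertex} (W : Finset T) (ξ : Config T) (q : Vertex) (k : ℕ) :
    cylinderWeight W ξ q k ≤ unitWeight k := by
  classical
  by_cases hq : q ∈ W.map (Function.Embedding.subtype _)
  · obtain ⟨w, hw, rfl⟩ := Finset.mem_map.1 hq
    rw [Function.Embedding.subtype_apply, cylinderWeight_of_mem ξ hw]
    split_ifs with h
    · rw [unitWeight, if_pos (h ▸ height_le _)]
    · exact unitWeight_nonneg k
  · rw [cylinderWeight_of_notMem ξ hq]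

theorem cylinderWeight_zero_of_le {T : Set Vertex} (W : Finset T) (ξ : Config T) (q : Vertex) (k : ℕ)
    (hk : 4 ≤ k) : cylinderWeight W ξ q k = 0 :=
  le_antisymm ((cylinderWeight_le W ξ q k).trans (unitWeight_zero_of_le hk).le)
    (cylinderWeight_nonneg W ξ q k)

/-- On stable configurations the product of these weights is the indicator of the cylinder. -/
theorem pf_cylinderWeight {T : Set Vertex} (W : Finset T) (ξ : Config T) (T' : Finset Vertex) :
    pf T' (cylinderWeight W ξ) = ((recurrent (T' : Set Vertex) ∩ cylinder W ξ T').ncard : ℝ) := by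
  classical
  rw [pf, sum_confs_eq_sum_config T' fun h =>
    if IsRec T' h then ∏ q ∈ T', cylinderWeight W ξ q (h q) else 0]
  have key : ∀ η : Config (T' : Set Vertex),
      (if IsRec T' (extendConfig 0 η) then ∏ q ∈ T', cylinderWeight W ξ q (extendConfig 0 η q)
        else 0) = if η ∈ recurrent (T' : Set Vertex) ∩ cylinder W ξ T' then (1 : ℝ) else 0 := by
    intro η
    simp only [Set.mem_inter_iff, mem_recurrent_iff 0]
    by_cases hr : IsRec T' (extendConfig 0 η)
    · by_cases hc : η ∈ cylinder W ξ (T' : Set Vertex)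
      · rw [if_pos hr, if_pos ⟨hr, hc⟩]
        refine Finset.prod_eq_one fun q hq => ?_
        have hq' : q ∈ (T' : Set Vertex) := hq
        rw [extendConfig_of_mem 0 η hq']
        by_cases hqW : q ∈ W.map (Function.Embedding.subtype _)
        · obtain ⟨w, hw, rfl⟩ := Finset.mem_map.1 hqW
          exact (cylinderWeight_of_mem ξ hw _).trans (if_pos (congrArg Subtype.val (hc w hw hq')))
        · rw [cylinderWeight_of_notMem ξ hqW, unitWeight, if_pos (height_le _)]
      · rw [if_pos hr, if_neg fun h => hc h.2]
        simp only [cylinder, Set.mem_ofPred_eq, not_forall] at hc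
        obtain ⟨w, hw, hwT, hne⟩ := hc
        refine Finset.prod_eq_zero (i := (w : Vertex)) hwT ?_
        rw [cylinderWeight_of_mem ξ hw, extendConfig_of_mem 0 η hwT, if_neg]
        exact fun h => hne (Subtype.ext h)
    · rw [if_neg hr, if_neg fun h => hr h.1]
  simp only [key]
  rw [Finset.sum_boole, ← Set.ncard_coe_finset]
  congr 2
  ext η
  simp

theorem uniformOn_real_apply {Ω : Type*} [Finite Ω] [MeasurableSpace Ω]
    [MeasurableSingletonClass Ω] (s t : Set Ω) :
    (ProbabilityTheory.uniformOn s).real t = ((s ∩ t).ncard : ℝ) / s.ncard := by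
  classical
  lift s to Finset Ω using s.toFinite
  lift t to Finset Ω using t.toFinite
  rw [measureReal_def, ProbabilityTheory.uniformOn_apply_finset, ← Finset.coe_inter,
    Set.ncard_coe_finset, Set.ncard_coe_finset, ENNReal.toReal_div, ENNReal.toReal_natCast,
    ENNReal.toReal_natCast]

/-- The probability of a cylinder in terms of the ratios of the branches outside `T₀`. -/
def gibbs {T : Set Vertex} (x : Vertex → Vertex → ℝ) (T₀ : Finset Vertex) (W : Finset T)
    (ξ : Config T) : ℝ :=
  pf T₀ (effWeight x T₀ (cylinderWeight W ξ)) / pf T₀ (effWeight x T₀ fun _ => unitWeight)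

theorem pf_effWeight_unitWeight_pos {T : Finset Vertex} (hT : IsSubtree (T : Set Vertex))
    {x : Vertex → Vertex → ℝ} (hx : ∀ p q, 0 ≤ x p q) :
    0 < pf T (effWeight x T fun _ => unitWeight) := by
  refine pf_pos hT (fun q _ => absorb_nonneg (hx q) unitWeight_nonneg) fun q _ k hk => ?_
  refine lt_of_lt_of_le ?_ (le_absorb (hx q) unitWeight_nonneg k)
  rw [unitWeight, if_pos (Finset.mem_Icc.1 hk).2]
  exact one_pos

theorem pf_unitWeight_eq_ncard (T : Finset Vertex) :
    pf T (fun _ => unitWeight) = ((recurrent (T : Set Vertex)).ncard : ℝ) := by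
  have h := pf_cylinderWeight (T := (T : Set Vertex)) ∅ (fun _ => ⟨1, by simp⟩) T
  have hc : cylinder (T := (T : Set Vertex)) ∅ (fun _ => ⟨1, by simp⟩) (T : Set Vertex) =
      Set.univ := by
    ext η
    simp [cylinder]
  rw [hc, Set.inter_univ] at h
  rw [← h]
  exact pf_congr fun q _ => (cylinderWeight_of_notMem _ (by simp)).symm

theorem recurrent_nonempty {T : Set Vertex} (hT : IsSubtree T) (hfin : T.Finite) :
    (recurrent T).Nonempty := by
  lift T to Finset Vertex using hfin
  have h : 0 < pf T fun _ => unitWeight := by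
    refine pf_pos hT (fun _ _ => unitWeight_nonneg) fun q _ k hk => ?_
    rw [unitWeight, if_pos (Finset.mem_Icc.1 hk).2]
    exact one_pos
  rw [pf_unitWeight_eq_ncard, Nat.cast_pos] at h
  exact Set.nonempty_of_ncard_ne_zero h.ne'

/-- The factor from summing out the complement of `T₀` is the same for the cylinder as for the full
count, because the cylinder imposes nothing outside `T₀`; it cancels. -/
theorem uniformOn_cylinder_eq_gibbs {T T' : Set Vertex} (hT' : IsSubtree T') (hfin : T'.Finite)
    {T₀ : Finset Vertex} (hT₀ : IsSubtree (T₀ : Set Vertex)) (hsub : ↑T₀ ⊆ T') (W : Finset T)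
    (hW : W.map (Function.Embedding.subtype _) ⊆ T₀) (ξ : Config T) :
    (ProbabilityTheory.uniformOn (recurrent T')).real (cylinder W ξ T') =
      gibbs (branchRatio T') T₀ W ξ := by
  lift T' to Finset Vertex using hfin
  obtain ⟨c, hc, h⟩ := exists_pf_eq_mul_pf hT' _ T₀ hT₀ (by exact_mod_cast hsub) rfl
  rw [uniformOn_real_apply, ← pf_cylinderWeight, ← pf_unitWeight_eq_ncard,
    h _ (cylinderWeight_zero_of_le W ξ) fun q hq => cylinderWeight_of_notMem ξ fun hq' => hq (hW hq'),
    h (fun _ => unitWeight) (fun _ _ => unitWeight_zero_of_le) fun _ _ => rfl,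
    mul_div_mul_left _ _ hc.ne', gibbs]

/-! ### The net of finite subtrees -/

theorem IsSubtree.isDirected {T : Set Vertex} (hT : IsSubtree T) :
    IsDirected (FiniteSubtree T) (· ≤ ·) := by
  refine ⟨fun A B => ?_⟩
  obtain ⟨a, ha⟩ := A.2.1.nonempty
  have hfin := A.2.2.1.union B.2.2.1
  obtain ⟨C, hC, hsub, hCT⟩ := hT.exists_finite_superset (W := hfin.toFinset)
    ⟨a, by simpa using Or.inl ha⟩ (by simpa using ⟨A.2.2.2, B.2.2.2⟩)
  have hsub' : A.1 ∪ B.1 ⊆ (C : Set Vertex) := by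
    intro x hx
    exact hsub (by simpa using hx)
  exact ⟨⟨C, hC, C.finite_toSet, hCT⟩, fun x hx => hsub' (Or.inl hx), fun x hx => hsub' (Or.inr hx)⟩

theorem IsSubtree.nonempty_finiteSubtree {T : Set Vertex} (hT : IsSubtree T) :
    Nonempty (FiniteSubtree T) := by
  obtain ⟨v, hv⟩ := hT.nonempty
  exact ⟨⟨{v}, isSubtree_singleton v, Set.finite_singleton v, by simpa using hv⟩⟩

theorem IsSubtree.neBot_atTop {T : Set Vertex} (hT : IsSubtree T) :
    (atTop : Filter (FiniteSubtree T)).NeBot := by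
  have := hT.isDirected
  have := hT.nonempty_finiteSubtree
  infer_instance

theorem IsSubtree.eventually_superset {T : Set Vertex} (hT : IsSubtree T) {T₀ : Set Vertex}
    (h₀ : IsSubtree T₀) (hfin : T₀.Finite) (hsub : T₀ ⊆ T) :
    ∀ᶠ T' : FiniteSubtree T in atTop, T₀ ⊆ T'.1 := by
  have := hT.isDirected
  exact eventually_ge_atTop (⟨T₀, h₀, hfin, hsub⟩ : FiniteSubtree T)

theorem tendsto_eBranchRatio {T : Set Vertex} (hT : IsSubtree T) :
    Tendsto (fun T' : FiniteSubtree T => eBranchRatio T'.1) atTop (𝓝 (eBranchRatio T)) := by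
  have := hT.neBot_atTop
  have hmono : Monotone fun T' : FiniteSubtree T => eBranchRatio T'.1 :=
    fun A B h => eBranchRatio_mono h
  have hlim := tendsto_atTop_iSup hmono
  set Y := ⨆ T' : FiniteSubtree T, eBranchRatio T'.1
  have hY : Y = eBranchRatio T := by
    refine le_antisymm (iSup_le fun T' => eBranchRatio_mono T'.2.2.2) ?_
    refine OrderHom.lfp_le _ fun p q => ?_
    classical
    change (if q ∈ T then (∑ a ∈ (nbrs q).erase p, (1 + Y q a)⁻¹)⁻¹ else 0) ≤ Y p q
    split_ifs with hq
    · have hlim' : ∀ a b, Tendsto (fun T' : FiniteSubtree T => eBranchRatio T'.1 a b) atTop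
          (𝓝 (Y a b)) := fun a b => (tendsto_pi_nhds.1 (tendsto_pi_nhds.1 hlim a) b)
      -- Every finite subtree containing `q` satisfies the recursion at `q`, and the recursion is
      -- continuous in `ENNReal`, so the supremum satisfies it too.
      refine le_of_eq (tendsto_nhds_unique ?_ (hlim' p q))
      have h1 : Tendsto (fun T' : FiniteSubtree T =>
          (∑ a ∈ (nbrs q).erase p, (1 + eBranchRatio T'.1 q a)⁻¹)⁻¹) atTop
          (𝓝 (∑ a ∈ (nbrs q).erase p, (1 + Y q a)⁻¹)⁻¹) := by
        refine tendsto_inv_iff.2 (tendsto_finsetSum _ fun a _ => ?_)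
        exact tendsto_inv_iff.2 (tendsto_const_nhds.add (hlim' q a))
      refine h1.congr' ?_
      filter_upwards [hT.eventually_superset (isSubtree_singleton q) (Set.finite_singleton q)
        (by simpa using hq)] with T' hT'
      exact (eBranchRatio_of_mem p (by simpa using hT')).symm
    · exact zero_le
  rwa [hY] at hlim

theorem tendsto_branchRatio {T : Set Vertex} (hT : IsSubtree T) (p q : Vertex) :
    Tendsto (fun T' : FiniteSubtree T => branchRatio T'.1 p q) atTop (𝓝 (branchRatio T p q)) :=
  (ENNReal.tendsto_toReal ((eBranchRatio_le_one T p q).trans_lt ENNReal.one_lt_top).ne).comp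
    (tendsto_pi_nhds.1 (tendsto_pi_nhds.1 (tendsto_eBranchRatio hT) p) q)

theorem tendsto_pf_effWeight {ι : Type*} {l : Filter ι} {x : ι → Vertex → Vertex → ℝ}
    {y : Vertex → Vertex → ℝ} (h : ∀ p q, Tendsto (fun i => x i p q) l (𝓝 (y p q)))
    (T₀ : Finset Vertex) (f : Vertex → ℕ → ℝ) :
    Tendsto (fun i => pf T₀ (effWeight (x i) T₀ f)) l (𝓝 (pf T₀ (effWeight y T₀ f))) := by
  unfold pf effWeight absorb
  refine tendsto_finsetSum _ fun c _ => ?_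
  split_ifs
  · exact tendsto_finsetProd _ fun q _ => tendsto_finsetSum _ fun B _ =>
      (tendsto_finsetProd _ fun b _ => h q b).mul_const _
  · exact tendsto_const_nhds

theorem tendsto_uniformOn_cylinder {T : Set Vertex} (hT : IsSubtree T) {T₀ : Finset Vertex}
    (hT₀ : IsSubtree (T₀ : Set Vertex)) (hsub : ↑T₀ ⊆ T) (W : Finset T)
    (hW : W.map (Function.Embedding.subtype _) ⊆ T₀) (ξ : Config T) :
    Tendsto (fun T' : FiniteSubtree T =>
        (ProbabilityTheory.uniformOn (recurrent T'.1)).real (cylinder W ξ T'.1)) atTop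
      (𝓝 (gibbs (branchRatio T) T₀ W ξ)) := by
  have hlim : Tendsto (fun T' : FiniteSubtree T => gibbs (branchRatio T'.1) T₀ W ξ) atTop
      (𝓝 (gibbs (branchRatio T) T₀ W ξ)) :=
    (tendsto_pf_effWeight (tendsto_branchRatio hT) T₀ _).div
      (tendsto_pf_effWeight (tendsto_branchRatio hT) T₀ _)
      (pf_effWeight_unitWeight_pos hT₀ (branchRatio_nonneg T)).ne'
  refine hlim.congr' ?_
  filter_upwards [hT.eventually_superset hT₀ T₀.finite_toSet hsub] with T' hT'
  exact (uniformOn_cylinder_eq_gibbs T'.2.1 T'.2.2.1 hT₀ hT' W hW ξ).symm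

/-- One formula serves finite and infinite `T`; uniqueness and the covariance bound both rest on it.
-/
theorem IsUniformRecurrent.real_cylinder {T : Set Vertex} (hT : IsSubtree T)
    {μ : Measure (Config T)} (hμ : IsUniformRecurrent T μ) {T₀ : Finset Vertex}
    (hT₀ : IsSubtree (T₀ : Set Vertex)) (hsub : ↑T₀ ⊆ T) (W : Finset T)
    (hW : W.map (Function.Embedding.subtype _) ⊆ T₀) (ξ : Config T) :
    μ.real (cylinder W ξ T) = gibbs (branchRatio T) T₀ W ξ := by
  rcases T.finite_or_infinite with hfin | hinf
  · rw [hμ.1 hfin]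
    exact uniformOn_cylinder_eq_gibbs hT hfin hT₀ hsub W hW ξ
  · have := hT.neBot_atTop
    exact tendsto_nhds_unique ((hμ.2 hinf).2 W ξ) (tendsto_uniformOn_cylinder hT hT₀ hsub W hW ξ)

/-! ### Existence and uniqueness of the limit measure -/

theorem isClopen_cylinder {T : Set Vertex} (W : Finset T) (ξ : Config T) :
    IsClopen (cylinder W ξ T) := by
  have h : cylinder W ξ T = ⋂ w ∈ W, (fun η : Config T => η w) ⁻¹' {ξ w} := by
    ext η
    simp only [cylinder, Set.mem_ofPred_eq, Set.mem_iInter, Set.mem_preimage,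
      Set.mem_singleton_iff]
    exact ⟨fun h w hw => h w hw w.2, fun h w hw _ => h w hw⟩
  rw [h]
  exact isClopen_biInter_finset fun w _ => (isClopen_discrete _).preimage (continuous_apply w)

/-- The configuration on `T` which agrees with `η` on `T'` and has height one elsewhere. -/
def fillConfig (T : Set Vertex) {T' : Set Vertex} (η : Config T') : Config T :=
  fun q => open Classical in if h : (q : Vertex) ∈ T' then η ⟨q, h⟩ else ⟨1, by simp⟩

/-- The uniform measure on the recurrent configurations of a finite subtree of `T` as a measure on
the configurations of `T`. -/
def fillMeasure {T : Set Vertex} (T' : FiniteSubtree T) : Measure (Config T) :=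
  (ProbabilityTheory.uniformOn (recurrent T'.1)).map (fillConfig T)

theorem measurable_fillConfig {T : Set Vertex} (T' : FiniteSubtree T) :
    Measurable (fillConfig T (T' := T'.1)) := by
  have := T'.2.2.1.to_subtype
  exact measurable_of_finite _

instance isProbabilityMeasure_fillMeasure {T : Set Vertex} (T' : FiniteSubtree T) :
    IsProbabilityMeasure (fillMeasure T') := by
  have := T'.2.2.1.to_subtype
  have : IsProbabilityMeasure (ProbabilityTheory.uniformOn (recurrent T'.1)) :=
    ProbabilityTheory.isProbabilityMeasure_uniformOn (Set.toFinite _)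
      (recurrent_nonempty T'.2.1 T'.2.2.1)
  exact Measure.isProbabilityMeasure_map (measurable_fillConfig T').aemeasurable

theorem fillMeasure_real_cylinder {T : Set Vertex} (T' : FiniteSubtree T) (W : Finset T)
    (hW : ∀ w ∈ W, (w : Vertex) ∈ T'.1) (ξ : Config T) :
    (fillMeasure T').real (cylinder W ξ T) =
      (ProbabilityTheory.uniformOn (recurrent T'.1)).real (cylinder W ξ T'.1) := by
  rw [fillMeasure, map_measureReal_apply (measurable_fillConfig T')
    (isClopen_cylinder W ξ).isOpen.measurableSet]
  congr 1
  ext η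
  simp only [cylinder, Set.mem_preimage, Set.mem_ofPred_eq]
  refine forall_congr' fun w => forall_congr' fun hw => ?_
  have h : fillConfig T η w = η ⟨w, hW w hw⟩ := dif_pos (hW w hw)
  exact ⟨fun h' _ => h ▸ h' w.2, fun h' _ => h.trans (h' (hW w hw))⟩

theorem IsSubtree.exists_finite_superset' {T : Set Vertex} (hT : IsSubtree T) (W : Finset T) :
    ∃ T₀ : Finset Vertex, IsSubtree (T₀ : Set Vertex) ∧ ↑T₀ ⊆ T ∧
      W.map (Function.Embedding.subtype _) ⊆ T₀ := by
  obtain ⟨v, hv⟩ := hT.nonempty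
  obtain ⟨T₀, h₀, hsub, hT₀⟩ := hT.exists_finite_superset
    (W := insert v (W.map (Function.Embedding.subtype _))) (Finset.insert_nonempty _ _) (by
      intro x hx
      rw [Finset.mem_coe, Finset.mem_insert] at hx
      rcases hx with rfl | hx
      · exact hv
      · obtain ⟨y, -, rfl⟩ := Finset.mem_map.1 hx
        exact y.2)
  exact ⟨T₀, h₀, hT₀, (Finset.subset_insert _ _).trans hsub⟩

/-- Probability measures on the compact configuration space form a compact space, so the filled-in
finite measures converge along an ultrafilter finer than the net. Cylinders are clopen, hence their
probabilities pass to the limit, where they must equal the limits already known along the whole net.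
-/
theorem exists_isUniformRecurrent {T : Set Vertex} (hT : IsSubtree T) :
    ∃ μ : Measure (Config T), IsUniformRecurrent T μ := by
  rcases T.finite_or_infinite with hfin | hinf
  · exact ⟨_, fun _ => rfl, fun h => absurd hfin h⟩
  have := hT.neBot_atTop
  let U : Ultrafilter (FiniteSubtree T) := Ultrafilter.of atTop
  have hU : (U : Filter (FiniteSubtree T)) ≤ atTop := Ultrafilter.of_le _
  let ν : FiniteSubtree T → ProbabilityMeasure (Config T) := fun T' => ⟨fillMeasure T', inferInstance⟩
  obtain ⟨μ, hμ⟩ : ∃ μ, Tendsto ν U (𝓝 μ) := ⟨(U.map ν).lim, (U.map ν).le_nhds_lim⟩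
  refine ⟨μ, fun h => absurd h hinf, fun _ => ⟨inferInstance, fun W ξ => ?_⟩⟩
  obtain ⟨T₀, hT₀, hsub, hW⟩ := hT.exists_finite_superset' W
  have hlim := tendsto_uniformOn_cylinder hT hT₀ hsub W hW ξ
  let _ := TopologicalSpace.metrizableSpaceMetric (Config T)
  have h1 := ProbabilityMeasure.tendsto_measure_of_isClopen_of_tendsto hμ (isClopen_cylinder W ξ)
  have h2 : Tendsto (fun T' : FiniteSubtree T => (fillMeasure T').real (cylinder W ξ T)) U
      (𝓝 ((μ : Measure (Config T)).real (cylinder W ξ T))) :=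
    (NNReal.tendsto_coe.2 h1)
  have h3 : Tendsto (fun T' : FiniteSubtree T => (fillMeasure T').real (cylinder W ξ T)) U
      (𝓝 (gibbs (branchRatio T) T₀ W ξ)) := by
    refine (hlim.mono_left hU).congr' ?_
    filter_upwards [hU (hT.eventually_superset hT₀ T₀.finite_toSet hsub)] with T' hT'
    refine (fillMeasure_real_cylinder T' W (fun w hw => hT' ?_) ξ).symm
    exact hW (Finset.mem_map_of_mem _ hw)
  rw [tendsto_nhds_unique h2 h3]
  exact hlim

theorem IsUniformRecurrent.isProbabilityMeasure {T : Set Vertex} (hT : IsSubtree T)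
    {μ : Measure (Config T)} (hμ : IsUniformRecurrent T μ) : IsProbabilityMeasure μ := by
  rcases T.finite_or_infinite with hfin | hinf
  · rw [hμ.1 hfin]
    have := hfin.to_subtype
    exact ProbabilityTheory.isProbabilityMeasure_uniformOn (Set.toFinite _)
      (recurrent_nonempty hT hfin)
  · exact (hμ.2 hinf).1

/-- Finite-dimensional marginals determine the measure, and the points of a marginal pull back to
cylinders. -/
theorem IsUniformRecurrent.unique {T : Set Vertex} (hT : IsSubtree T) {μ ν : Measure (Config T)}
    (hμ : IsUniformRecurrent T μ) (hν : IsUniformRecurrent T ν) : μ = ν := by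
  have := hμ.isProbabilityMeasure hT
  have := hν.isProbabilityMeasure hT
  refine IsProjectiveLimit.unique (P := fun J => ν.map J.restrict) (fun J => ?_) fun J => rfl
  refine Measure.ext_of_singleton fun y => ?_
  obtain ⟨T₀, hT₀, hsub, hW⟩ := hT.exists_finite_superset' J
  classical
  let ξ : Config T := fun q => if h : q ∈ J then y ⟨q, h⟩ else ⟨1, by simp⟩
  have hξ : ∀ (w : T) (hw : w ∈ J), ξ w = y ⟨w, hw⟩ := fun w hw => dif_pos hw
  have hpre : J.restrict ⁻¹' ({y} : Set (∀ _ : J, Height)) = cylinder J ξ T := by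
    ext η
    simp only [Set.mem_preimage, Set.mem_singleton_iff, cylinder, Set.mem_ofPred_eq, funext_iff]
    refine ⟨fun h w hw _ => ?_, fun h q => ?_⟩
    · exact (h ⟨w, hw⟩).trans (hξ w hw).symm
    · exact (h q q.2 q.1.2).trans (hξ q q.2)
  rw [Measure.map_apply (Finset.measurable_restrict J) (MeasurableSet.singleton y),
    Measure.map_apply (Finset.measurable_restrict J) (MeasurableSet.singleton y), hpre,
    ← ENNReal.toReal_eq_toReal_iff' (measure_ne_top _ _) (measure_ne_top _ _)]
  exact (hμ.real_cylinder hT hT₀ hsub J hW ξ).trans (hν.real_cylinder hT hT₀ hsub J hW ξ).symm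

/-! ### Covariances -/

/-- The indicator of the height `a`. -/
def heightWeight (a : Height) (k : ℕ) : ℝ := if k = a then 1 else 0

theorem heightWeight_nonneg (a : Height) (k : ℕ) : 0 ≤ heightWeight a k := by
  unfold heightWeight
  split_ifs <;> norm_num

theorem heightWeight_le (a : Height) (k : ℕ) : heightWeight a k ≤ unitWeight k := by
  unfold heightWeight
  split_ifs with h
  · rw [unitWeight, if_pos (h ▸ height_le a)]
  · exact unitWeight_nonneg k

/-- The path from `u` to `v` in `T` serves as `T₀`; the probabilities become quotients of partition
functions on it, to which `abs_pf_twoSite_le` applies. -/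
theorem abs_measureReal_inter_sub_le {T : Set Vertex} (hT : IsSubtree T) {μ : Measure (Config T)}
    (hμ : IsUniformRecurrent T μ) (u v : T) (a b : Height) :
    |μ.real ({η | η u = a} ∩ {η | η v = b}) - μ.real {η | η u = a} * μ.real {η | η v = b}| ≤
      2 * (1 / 4) ^ (bethe.induce T).dist u v := by
  have := hμ.isProbabilityMeasure hT
  by_cases huv : u = v
  · subst huv
    rw [SimpleGraph.dist_self, pow_zero, mul_one, abs_le]
    have h1 : 0 ≤ μ.real ({η | η u = a} ∩ {η | η u = b}) := measureReal_nonneg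
    have h2 : μ.real ({η | η u = a} ∩ {η | η u = b}) ≤ 1 := measureReal_le_one
    have h3 : 0 ≤ μ.real {η | η u = a} := measureReal_nonneg
    have h4 : μ.real {η | η u = a} ≤ 1 := measureReal_le_one
    have h5 : 0 ≤ μ.real {η | η u = b} := measureReal_nonneg
    have h6 : μ.real {η | η u = b} ≤ 1 := measureReal_le_one
    constructor <;> nlinarith
  obtain ⟨w, hw, hlen⟩ := hT.exists_path_of_dist u v
  let p : bethe.Walk u v := w.map (SimpleGraph.Embedding.induce (G := bethe) T).toHom
  have hp : p.IsPath := hw.map (SimpleGraph.Embedding.induce (G := bethe) T).injective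
  have hplen : p.length = (bethe.induce T).dist u v := by
    rw [← hlen]
    exact w.length_map _
  have huv' : (u : Vertex) ≠ v := fun h => huv (Subtype.ext h)
  have hsub : (p.support.toFinset : Set Vertex) ⊆ T := by
    intro x hx
    have hx' : x ∈ p.support := by simpa using hx
    have hsupp : p.support = w.support.map Subtype.val := SimpleGraph.Walk.support_map _ _
    rw [hsupp, List.mem_map] at hx'
    obtain ⟨y, -, rfl⟩ := hx'
    exact y.2
  have hus : (u : Vertex) ∈ p.support.toFinset := by simp
  have hvs : (v : Vertex) ∈ p.support.toFinset := by simp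
  classical
  set S := p.support.toFinset
  have hS : IsSubtree (S : Set Vertex) := isSubtree_support p
  let ξ : Config T := Function.update (fun _ => b) u a
  have hξu : ξ u = a := Function.update_self _ _ _
  have hξv : ξ v = b := Function.update_of_ne (Ne.symm huv) _ _
  let Z := fun φ ψ => pf S (effWeight (branchRatio T) S (twoSite u v φ ψ))
  -- Treats the joint event and both single events at once, with `W` equal to `{u, v}`, `{u}` or
  -- `{v}`.
  have key : ∀ (W : Finset T) (A : Set (Config T)) (φ ψ : ℕ → ℝ), W ⊆ {u, v} →
      cylinder W ξ T = A →
      φ = (if u ∈ W then heightWeight a else unitWeight) →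
      ψ = (if v ∈ W then heightWeight b else unitWeight) →
      μ.real A = Z φ ψ / Z unitWeight unitWeight := by
    rintro W A φ ψ hW rfl rfl rfl
    have hWS : W.map (Function.Embedding.subtype _) ⊆ S := by
      intro x hx
      obtain ⟨y, hy, rfl⟩ := Finset.mem_map.1 hx
      rcases Finset.mem_insert.1 (hW hy) with rfl | h
      · exact hus
      · rw [Finset.mem_singleton.1 h]
        exact hvs
    rw [hμ.real_cylinder hT hS hsub W hWS ξ, gibbs]
    have hunit : twoSite (u : Vertex) v unitWeight unitWeight = fun _ => unitWeight := by
      rw [twoSite, Function.update_eq_self_iff.2 rfl]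
      simp
    have hcyl : cylinderWeight W ξ = twoSite (u : Vertex) v
        (if u ∈ W then heightWeight a else unitWeight)
        (if v ∈ W then heightWeight b else unitWeight) := by
      have hmem : ∀ q : T, q ∉ W → (q : Vertex) ∉ W.map (Function.Embedding.subtype _) := by
        intro q hq hq'
        obtain ⟨y, hy, hyq⟩ := Finset.mem_map.1 hq'
        exact hq ((Subtype.ext hyq : y = q) ▸ hy)
      ext q k
      rw [twoSite]
      by_cases hqu : q = u
      · subst hqu
        rw [Function.update_self]
        split_ifs with h
        · rw [cylinderWeight_of_mem ξ h, hξu, heightWeight]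
        · rw [cylinderWeight_of_notMem ξ (hmem u h)]
      · rw [Function.update_of_ne hqu]
        by_cases hqv : q = v
        · subst hqv
          rw [Function.update_self]
          split_ifs with h
          · rw [cylinderWeight_of_mem ξ h, hξv, heightWeight]
          · rw [cylinderWeight_of_notMem ξ (hmem v h)]
        · rw [Function.update_of_ne hqv, cylinderWeight_of_notMem]
          intro hq
          obtain ⟨y, hy, rfl⟩ := Finset.mem_map.1 hq
          rcases Finset.mem_insert.1 (hW hy) with rfl | h
          · exact hqu rfl
          · exact hqv (by rw [Finset.mem_singleton.1 h]; rfl)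
    rw [hcyl]
    change _ = _ / pf S (effWeight (branchRatio T) S (twoSite u v unitWeight unitWeight))
    rw [hunit]
  have hab := key {u, v} ({η | η u = a} ∩ {η | η v = b}) (heightWeight a) (heightWeight b)
    subset_rfl (by ext η; simp [cylinder, hξu, hξv]) (by simp) (by simp)
  have ha := key {u} {η | η u = a} (heightWeight a) unitWeight
    (by simp) (by ext η; simp [cylinder, hξu]) (by simp) (by simp [Ne.symm huv])
  have hb := key {v} {η | η v = b} unitWeight (heightWeight b)
    (by simp) (by ext η; simp [cylinder, hξv]) (by simp [huv]) (by simp)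
  have hunit : twoSite (u : Vertex) v unitWeight unitWeight = fun _ => unitWeight := by
    rw [twoSite, Function.update_eq_self_iff.2 rfl]
    simp
  have hpos : 0 < Z unitWeight unitWeight := by
    change 0 < pf S (effWeight (branchRatio T) S (twoSite u v unitWeight unitWeight))
    rw [hunit]
    exact pf_effWeight_unitWeight_pos hS (branchRatio_nonneg T)
  have hmain := abs_pf_twoSite_le (branchRatio_nonneg T) (branchRatio_le_one T) p hp huv'
    (heightWeight_nonneg a) (heightWeight_le a) (heightWeight_nonneg b) (heightWeight_le b)
  rw [hplen] at hmain
  have e : Z (heightWeight a) (heightWeight b) / Z unitWeight unitWeight -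
      Z (heightWeight a) unitWeight / Z unitWeight unitWeight *
        (Z unitWeight (heightWeight b) / Z unitWeight unitWeight) =
      (Z (heightWeight a) (heightWeight b) * Z unitWeight unitWeight -
        Z (heightWeight a) unitWeight * Z unitWeight (heightWeight b)) /
          Z unitWeight unitWeight ^ 2 := by
    field_simp
  rw [hab, ha, hb, e, abs_div, abs_of_pos (pow_pos hpos 2), div_le_iff₀ (pow_pos hpos 2)]
  exact hmain

theorem measurableSet_height_eq {T : Set Vertex} (u : T) (a : Height) :
    MeasurableSet {η : Config T | η u = a} :=
  measurableSet_eq_fun (measurable_pi_apply u) measurable_const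

theorem height_eq_sum {T : Set Vertex} (η : Config T) (u : T) :
    ((η u : ℕ) : ℝ) = ∑ a : Height, ((a : ℕ) : ℝ) * {η : Config T | η u = a}.indicator 1 η := by
  rw [Finset.sum_eq_single (η u)]
  · simp
  · intro a _ ha
    simp [ha.symm]
  · simp

theorem integral_height {T : Set Vertex} (μ : Measure (Config T)) [IsProbabilityMeasure μ] (u : T) :
    ∫ η, ((η u : ℕ) : ℝ) ∂μ = ∑ a : Height, ((a : ℕ) : ℝ) * μ.real {η | η u = a} := by
  simp only [height_eq_sum]
  rw [integral_finsetSum _ fun a _ =>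
    ((integrable_const 1).indicator (measurableSet_height_eq u a)).const_mul _]
  refine Finset.sum_congr rfl fun a _ => ?_
  rw [integral_const_mul, integral_indicator_one (measurableSet_height_eq u a)]

theorem integral_height_mul_height {T : Set Vertex} (μ : Measure (Config T))
    [IsProbabilityMeasure μ] (u v : T) :
    ∫ η, ((η u : ℕ) : ℝ) * ((η v : ℕ) : ℝ) ∂μ =
      ∑ a : Height, ∑ b : Height, ((a : ℕ) : ℝ) * ((b : ℕ) : ℝ) *
        μ.real ({η | η u = a} ∩ {η | η v = b}) := by
  have hm : ∀ a b : Height, MeasurableSet ({η : Config T | η u = a} ∩ {η | η v = b}) :=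
    fun a b => (measurableSet_height_eq u a).inter (measurableSet_height_eq v b)
  have h : ∀ η : Config T, ((η u : ℕ) : ℝ) * ((η v : ℕ) : ℝ) =
      ∑ a : Height, ∑ b : Height, ((a : ℕ) : ℝ) * ((b : ℕ) : ℝ) *
        ({η : Config T | η u = a} ∩ {η | η v = b}).indicator 1 η := by
    intro η
    rw [height_eq_sum η u, height_eq_sum η v, Finset.sum_mul_sum]
    refine Finset.sum_congr rfl fun a _ => Finset.sum_congr rfl fun b _ => ?_
    rw [Set.inter_indicator_one, Pi.mul_apply]
    ring
  have hi : ∀ a b : Height, Integrable (fun η => ((a : ℕ) : ℝ) * ((b : ℕ) : ℝ) *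
      ({η : Config T | η u = a} ∩ {η | η v = b}).indicator 1 η) μ :=
    fun a b => ((integrable_const 1).indicator (hm a b)).const_mul _
  simp only [h]
  rw [integral_finsetSum _ fun a _ => integrable_finsetSum _ fun b _ => hi a b]
  refine Finset.sum_congr rfl fun a _ => ?_
  rw [integral_finsetSum _ fun b _ => hi a b]
  refine Finset.sum_congr rfl fun b _ => ?_
  rw [integral_const_mul, integral_indicator_one (hm a b)]

theorem sum_height : ∑ a : Height, ((a : ℕ) : ℝ) = 6 := by
  rw [Finset.sum_coe_sort (Finset.Icc 1 3) fun a : ℕ => (a : ℝ), sum_Icc_one_three]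
  norm_num

/-- Expand over pairs of heights: `72 = 2 * 6 ^ 2`, where `6 = 1 + 2 + 3`. -/
theorem abs_heightCov_le {T : Set Vertex} (hT : IsSubtree T) {μ : Measure (Config T)}
    (hμ : IsUniformRecurrent T μ) (u v : T) :
    |heightCov μ u v| ≤ 72 * (1 / 4) ^ (bethe.induce T).dist u v := by
  have := hμ.isProbabilityMeasure hT
  have h : heightCov μ u v = ∑ a : Height, ∑ b : Height, ((a : ℕ) : ℝ) * ((b : ℕ) : ℝ) *
      (μ.real ({η | η u = a} ∩ {η | η v = b}) - μ.real {η | η u = a} * μ.real {η | η v = b}) := by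
    rw [heightCov, integral_height_mul_height, integral_height, integral_height,
      Finset.sum_mul_sum, ← Finset.sum_sub_distrib]
    refine Finset.sum_congr rfl fun a _ => ?_
    rw [← Finset.sum_sub_distrib]
    exact Finset.sum_congr rfl fun b _ => by ring
  rw [h]
  calc _ ≤ ∑ a : Height, ∑ b : Height, ((a : ℕ) : ℝ) * ((b : ℕ) : ℝ) *
        (2 * (1 / 4) ^ (bethe.induce T).dist u v) := by
        refine (Finset.abs_sum_le_sum_abs _ _).trans (Finset.sum_le_sum fun a _ => ?_)
        refine (Finset.abs_sum_le_sum_abs _ _).trans (Finset.sum_le_sum fun b _ => ?_)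
        rw [abs_mul, abs_of_nonneg (by positivity : 0 ≤ ((a : ℕ) : ℝ) * ((b : ℕ) : ℝ))]
        exact mul_le_mul_of_nonneg_left (abs_measureReal_inter_sub_le hT hμ u v a b) (by positivity)
    _ = _ := by
      simp only [← Finset.sum_mul]
      rw [← Finset.sum_mul_sum, sum_height]
      ring

/-- Lowering the exponent to 1 already gives `8 / 25`. -/
theorem one_fourth_le_decayRate : 1 / 4 ≤ decayRate := by
  have h : (2 : ℝ) ^ (1 : ℝ) ≤ (2 : ℝ) ^ ((32 : ℝ) / 25) :=
    Real.rpow_le_rpow_of_exponent_le (by norm_num) (by norm_num)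
  rw [Real.rpow_one] at h
  rw [decayRate]
  linarith

/-! ### Summability -/

/-- The end points of the walks of length `n` from `u`. -/
def walkEnds : ℕ → Vertex → Finset Vertex
  | 0, u => {u}
  | n + 1, u => (nbrs u).biUnion (walkEnds n)

/-- Backtracking walks are counted too; the crude base 3 suffices against the rate 1/4. -/
theorem card_walkEnds_le (n : ℕ) (u : Vertex) : (walkEnds n u).card ≤ 3 ^ n := by
  induction n generalizing u with
  | zero => simp [walkEnds]
  | succ n ih =>
    rw [walkEnds]
    refine (Finset.card_biUnion_le_card_mul _ _ _ fun w _ => ih w).trans ?_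
    rw [card_nbrs, pow_succ']

theorem mem_walkEnds {u v : Vertex} (p : bethe.Walk u v) : v ∈ walkEnds p.length u := by
  induction p with
  | nil => simp [walkEnds]
  | cons h p ih => exact Finset.mem_biUnion.2 ⟨_, mem_nbrs.2 h, ih⟩

/-- Group by distance: the shell at distance `n` contributes at most `(3 / 4) ^ n`. -/
theorem sum_one_fourth_pow_dist_le {T : Set Vertex} (hT : IsSubtree T) (u : T) (S : Finset T) :
    ∑ v ∈ S, (1 / 4 : ℝ) ^ (bethe.induce T).dist u v ≤ 4 := by
  classical
  have hcard : ∀ n, ((S.filter fun v => (bethe.induce T).dist u v = n).card : ℝ) ≤ 3 ^ n := by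
    intro n
    have h : ((S.filter fun v => (bethe.induce T).dist u v = n).map
        (Function.Embedding.subtype _)) ⊆ walkEnds n u := by
      intro x hx
      obtain ⟨v, hv, rfl⟩ := Finset.mem_map.1 hx
      obtain ⟨w, hw⟩ := hT.exists_walk_length_eq_dist u v
      have := mem_walkEnds (w.map (SimpleGraph.Embedding.induce (G := bethe) T).toHom)
      rwa [SimpleGraph.Walk.length_map, hw, (Finset.mem_filter.1 hv).2] at this
    have h' := (Finset.card_le_card h).trans (card_walkEnds_le n u)
    rw [Finset.card_map] at h'
    exact_mod_cast h'
  rw [Finset.sum_comp (fun n => (1 / 4 : ℝ) ^ n) fun v => (bethe.induce T).dist u v]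
  have hr0 : (0 : ℝ) ≤ 3 / 4 := by norm_num
  have hr1 : (3 / 4 : ℝ) < 1 := by norm_num
  calc _ ≤ ∑ n ∈ S.image fun v => (bethe.induce T).dist u v, (3 / 4 : ℝ) ^ n := by
        refine Finset.sum_le_sum fun n _ => ?_
        rw [nsmul_eq_mul]
        calc _ ≤ (3 : ℝ) ^ n * (1 / 4) ^ n := by gcongr; exact hcard n
          _ = _ := by rw [← mul_pow]; norm_num
    _ ≤ ∑' n : ℕ, (3 / 4 : ℝ) ^ n :=
      (summable_geometric_of_lt_one hr0 hr1).sum_le_tsum _ fun n _ => by positivity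
    _ = 4 := by
      rw [tsum_geometric_of_lt_one hr0 hr1]
      norm_num

theorem sum_abs_heightCov_le {T : Set Vertex} (hT : IsSubtree T) {μ : Measure (Config T)}
    (hμ : IsUniformRecurrent T μ) (u : T) (S : Finset T) :
    ∑ v ∈ S, |heightCov μ u v| ≤ 288 := by
  calc _ ≤ ∑ v ∈ S, 72 * (1 / 4 : ℝ) ^ (bethe.induce T).dist u v :=
        Finset.sum_le_sum fun v _ => abs_heightCov_le hT hμ u v
    _ = 72 * ∑ v ∈ S, (1 / 4 : ℝ) ^ (bethe.induce T).dist u v := (Finset.mul_sum _ _ _).symm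
    _ ≤ _ := by linarith [sum_one_fourth_pow_dist_le hT u S]

end

end Sandpile

theorem theorem6p1 :
    (∀ T : Set Sandpile.Vertex, Sandpile.IsSubtree T →
      ∃! μ : Measure (Sandpile.Config T), Sandpile.IsUniformRecurrent T μ) ∧
    (∃ C : ℝ, ∀ T : Set Sandpile.Vertex, Sandpile.IsSubtree T →
      ∀ μ : Measure (Sandpile.Config T), Sandpile.IsUniformRecurrent T μ →
        ∀ u v : T,
          |Sandpile.heightCov μ u v| ≤
            C * Sandpile.decayRate ^ (Sandpile.bethe.induce T).dist u v) ∧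
    (∃ K : ℝ, ∀ T : Set Sandpile.Vertex, Sandpile.IsSubtree T →
      ∀ μ : Measure (Sandpile.Config T), Sandpile.IsUniformRecurrent T μ →
        ∀ u : T,
          Summable (fun v : T => |Sandpile.heightCov μ u v|) ∧
            ∑' v : T, |Sandpile.heightCov μ u v| ≤ K) := by
  refine ⟨fun T hT => ?_, ⟨72, fun T hT μ hμ u v => ?_⟩, ⟨288, fun T hT μ hμ u => ?_⟩⟩
  · obtain ⟨μ, hμ⟩ := Sandpile.exists_isUniformRecurrent hT
    exact ⟨μ, hμ, fun ν hν => hν.unique hT hμ⟩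
  · refine (Sandpile.abs_heightCov_le hT hμ u v).trans ?_
    gcongr
    exact Sandpile.one_fourth_le_decayRate
  · have h := Sandpile.sum_abs_heightCov_le hT hμ u
    exact ⟨summable_of_sum_le (fun _ => abs_nonneg _) h,
      Real.tsum_le_of_sum_le (fun _ => abs_nonneg _) h⟩
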